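/- Let $\mathbb T=\mathbb R/\mathbb Z$ (identified with $[0,1]$), and let $W:\mathbb T\to\mathbb R$ be given by $W(x)=-32x+4$ on $[0,\frac14]$, $W(x)=32x-12$ on $[\frac14,\frac12]$, $W(x)=-32x+20$ on $[\frac12,\frac34]$, $W(x)=32x-28$ on $[\frac34,1]$. For $g\in L^1(\mathbb T)$ put $\langle g\rangle:=g-\int_{\mathbb T}g\,dx$. For $\varepsilon>0$, a pair $(u,m)\in W^{1,4}(\mathbb T)\times L^2(\mathbb T)$ is a weak solution of the discount problem $$\varepsilon u+\tfrac12|u_x|^2+W(x)=m,\qquad \varepsilon m-(m u_x)_x=\varepsilon\qquad\text{in }\mathbb T \tag{D$_\varepsilon$}$$ if $m\ge0$ a.e., $\int_{\mathbb T} m\,dx=1$, $mu_x\in L^1(\mathbb T)$, $\varepsilon u+\frac12|u_x|^2+W=m$ a.e. in $\{m>0\}$, $\varepsilon u+\frac12|u_x|^2+W\le m$ a.e. in $\mathbb T$, and the second equation holds in the sense of distributions. A triple $(u,m,\lambda)\in W^{1,4}(\mathbb T)\times L^2(\mathbb T)\times\mathbb R$ is a weak solution of the ergodic problem $$\tfrac12|u_x|^2+W(x)=m+\lambda,\qquad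 -(mu_x)_x=0\qquad\text{in }\mathbb T \tag{E}$$ if $m\ge0$ a.e., $\int_{\mathbb T} m\,dx=1$, $mu_x\in L^1(\mathbb T)$, $\frac12|u_x|^2+W=m+\lambda$ a.e. in $\{m>0\}$, $\frac12|u_x|^2+W\le m+\lambda$ a.e. in $\mathbb T$, and the second equation holds in the sense of distributions. For $\theta\in[\frac18,\frac38]$ and $C\in\mathbb R$ let $u^{\theta}(x)=\int_0^x u^\theta_x(y)\,dy+C$ for $x\in[0,1]$, where $$u^\theta_x=\sqrt{2\max\{-W,0\}}\;\chi_{(\frac18,\theta)\cup(\frac58,1-\theta)}-\sqrt{2\max\{-W,0\}}\;\chi_{(\theta,\frac38)\cup(1-\theta,\frac78)} ,$$ and let $\tilde u$ be $u^{\theta}$ with $\theta=\frac14$ and with $C$ chosen such that $\int_{\mathbb T}\tilde u\,dx=0$. Let $m:=\max\{W,0\}$. Then: (1) For every $\varepsilon>0$, (D$_\varepsilon$) has a unique weak solution $(u^\varepsilon,m^\varepsilon)$, up to equality a.e. (2) Taking continuous representatives of $u^\varepsilon\in W^{1,4}(\mathbb T)$, the whole family converges: $\langle u^\varepsilon\rangle\to\tilde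 u$ uniformly on $\mathbb T$ as $\varepsilon\to0^+$. (3) For all $\theta\in[\frac18,\frac38]$ and $C\in\mathbb R$, $(u^\theta,m,0)$ is a weak solution of (E), and different $\theta$ give functions that differ, even up to additive constants. (4) Let $\mathcal E$ be the set of all $u\in W^{1,4}(\mathbb T)$ such that $(u,m,0)$ is a weak solution of (E). Then $\tilde u\in\mathcal E$, $\tilde u$ minimises $u\mapsto\int_{\mathbb T}\langle u\rangle\,m\,dx$ over $\mathcal E$, and every minimiser equals $\tilde u$ a.e. up to an additive constant. -/

import Mathlib

open MeasureTheory Set Filter Topology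
open scoped ENNReal

noncomputable section

namespace MFG

/-- The one-dimensional flat torus `ℝ / ℤ`; its `volume` is the Lebesgue measure, of total mass 1. -/
abbrev Torus : Type := UnitAddCircle

/-- `ψ ∈ C¹(𝕋)` with derivative `ψ'`: both are continuous on the torus, and the 1-periodic lift of
`ψ` to the line has the lift of `ψ'` as its derivative at every point. -/
def IsC1WithDeriv (ψ ψ' : C(Torus, ℝ)) : Prop :=
  ∀ t : ℝ, HasDerivAt (fun s : ℝ => ψ (s : Torus)) (ψ' (t : Torus)) t

/-- `v` is a weak (distributional) derivative of `u` on the torus. -/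
def IsWeakDeriv (u v : Torus → ℝ) : Prop :=
  Integrable u ∧ Integrable v ∧
    ∀ ψ ψ' : C(Torus, ℝ), IsC1WithDeriv ψ ψ' → ∫ x, u x * ψ' x = - ∫ x, v x * ψ x

/-- `u ∈ W^{1,s}(𝕋)` with weak derivative `v` (which is unique up to null sets). -/
def IsSobolevWithDeriv (s : ℝ≥0∞) (u v : Torus → ℝ) : Prop :=
  MemLp u s ∧ MemLp v s ∧ IsWeakDeriv u v

/-- `(u, m) ∈ W^{1,s}(𝕋) × L^q(𝕋)` is a weak solution of the discount mean field game
`ε u + H(x, u_x) = f(x, m)`, `ε m - (m D_pH(x, u_x))_x = ε` on the torus.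
Here `v` is the weak derivative of `u`. -/
def IsDiscountWeakSolution (H f : Torus → ℝ → ℝ) (s q : ℝ≥0∞) (ε : ℝ) (u m : Torus → ℝ) : Prop :=
  ∃ v : Torus → ℝ, IsSobolevWithDeriv s u v ∧ MemLp m q ∧
    (∀ᵐ x, 0 ≤ m x) ∧ (∫ x, m x = 1) ∧
    Integrable (fun x => m x * deriv (H x) (v x)) ∧
    (∀ᵐ x, 0 < m x → ε * u x + H x (v x) = f x (m x)) ∧
    (∀ᵐ x, ε * u x + H x (v x) ≤ f x (m x)) ∧
    (∀ ψ ψ' : C(Torus, ℝ), IsC1WithDeriv ψ ψ' →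
      ε * (∫ x, m x * ψ x) + ∫ x, m x * deriv (H x) (v x) * ψ' x = ε * ∫ x, ψ x)

/-- `(u, m, lam) ∈ W^{1,s}(𝕋) × L^q(𝕋) × ℝ` is a weak solution of the ergodic problem
`H(x, u_x) = f(x, m) + lam`, `-(m D_pH(x, u_x))_x = 0` on the torus.
Here `v` is the weak derivative of `u`. -/
def IsErgodicWeakSolution (H f : Torus → ℝ → ℝ) (s q : ℝ≥0∞) (u m : Torus → ℝ) (lam : ℝ) : Prop :=
  ∃ v : Torus → ℝ, IsSobolevWithDeriv s u v ∧ MemLp m q ∧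
    (∀ᵐ x, 0 ≤ m x) ∧ (∫ x, m x = 1) ∧
    Integrable (fun x => m x * deriv (H x) (v x)) ∧
    (∀ᵐ x, 0 < m x → H x (v x) = f x (m x) + lam) ∧
    (∀ᵐ x, H x (v x) ≤ f x (m x) + lam) ∧
    (∀ ψ ψ' : C(Torus, ℝ), IsC1WithDeriv ψ ψ' →
      ∫ x, m x * deriv (H x) (v x) * ψ' x = 0)

/-- `⟨g⟩ = g - ∫ g`. -/
def bracket (g : Torus → ℝ) : Torus → ℝ := fun x => g x - ∫ y, g y

/-- The potential on the fundamental domain `[0, 1]`. -/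
def potentialReal (x : ℝ) : ℝ :=
  if x ≤ 1 / 4 then -32 * x + 4
  else if x ≤ 1 / 2 then 32 * x - 12
  else if x ≤ 3 / 4 then -32 * x + 20
  else 32 * x - 28

/-- The potential `W` on the torus. -/
def W : Torus → ℝ := AddCircle.liftIco 1 0 potentialReal

/-- The Hamiltonian `H(x, p) = |p|² / 2 + W(x)`; here `r = 2`. -/
def ham (x : Torus) (p : ℝ) : ℝ := |p| ^ 2 / 2 + W x

/-- The coupling `f(x, m) = m`; here `q = 2` and its conjugate exponent is `p = 2`. -/
def coupling (_x : Torus) (m : ℝ) : ℝ := m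

/-- Weak solutions of the discount problem of the example, in `W^{1,4}(𝕋) × L²(𝕋)`. -/
def DiscountSol (ε : ℝ) (u m : Torus → ℝ) : Prop :=
  IsDiscountWeakSolution ham coupling 4 2 ε u m

/-- Weak solutions of the ergodic problem of the example, in `W^{1,4}(𝕋) × L²(𝕋) × ℝ`. -/
def ErgodicSol (u m : Torus → ℝ) (lam : ℝ) : Prop :=
  IsErgodicWeakSolution ham coupling 4 2 u m lam

/-- The ergodic density `m = max {W, 0}`. -/
def mErg (x : Torus) : ℝ := max (W x) 0

/-- The slope `u^θ_x` on the fundamental domain. -/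
def slopeTheta (θ x : ℝ) : ℝ :=
  Real.sqrt (2 * max (-potentialReal x) 0) *
      (Ioo (1 / 8) θ ∪ Ioo (5 / 8) (1 - θ)).indicator (fun _ => (1 : ℝ)) x
    - Real.sqrt (2 * max (-potentialReal x) 0) *
      (Ioo θ (3 / 8) ∪ Ioo (1 - θ) (7 / 8)).indicator (fun _ => (1 : ℝ)) x

/-- `u^θ(x) = ∫₀ˣ u^θ_x(y) dy + C`. -/
def uTheta (θ C : ℝ) : Torus → ℝ :=
  AddCircle.liftIco 1 0 (fun x : ℝ => (∫ y in (0 : ℝ)..x, slopeTheta θ y) + C)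

/-- `ũ`: the function `u^θ` for `θ = 1/4`, with `C` chosen so that the mean is zero. -/
def uTilde : Torus → ℝ := uTheta (1 / 4) (- ∫ x, uTheta (1 / 4) 0 x)

/-- The admissible class of the selection criterion: the `u` for which `(u, m, 0)`, with
`m = max {W, 0}`, is a weak solution of the ergodic problem. -/
def admissible : Set (Torus → ℝ) := {u | ErgodicSol u mErg 0}

/-- The functional `u ↦ ∫ ⟨u⟩ m dx` of the selection criterion. -/
def criterion (u : Torus → ℝ) : ℝ := ∫ x, bracket u x * mErg x

end MFG

end

/-! Uniqueness and convergence rest on one identity, `monotonicity_identity`: the difference of two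
Hamilton–Jacobi equations is tested with `m₁ - m₂`, and the difference of the two flux equations
with `u₁ - u₂`. Between two solutions of the same discount problem its right-hand side cancels,
whence uniqueness. Between a discounted solution and `(ũ, mErg, 0)` the right-hand side is `ε
(-criterion u + ∫ ũ (m - 1))`, see `DiscountData.comparison`. It is O(ε), so `m` tends to `mErg` in
L²; and it is nonnegative, so `criterion u ≤ criterion ũ + o(1)`.

The criterion is explicit. With G = `excess`, the primitive of `mErg - 1`, it equals `-∫ u_x G`, and
every admissible slope satisfies `|u_x| ≤ |ũ_x|`. On the two components of {W < 0}, G is `1/4 - t`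
and `3/4 - t`, which has exactly the sign of `ũ_x`. Therefore `criterion u - criterion ũ = ∫ (|ũ_x|
|G| - u_x G)` (`criterion_sub_eq`), which is nonnegative for admissible `u` and vanishes only if
`u_x = ũ_x` a.e.

Convergence is the quantitative form of this. Since `ε u → 0` uniformly, the Hamilton–Jacobi
equation gives `|u_x| → |ũ_x|`, and the small criterion gap then forces the sign of `u_x` away from
the zeros 1/4 and 3/4 of G (`abs_sub_le_of_aligned`). With `ε = k ^ 8` the L¹ distance of the slopes
is at most `10000 k`, and a Poincaré inequality yields uniform convergence.

For existence, the discount problem is the Euler–Lagrange system of the convex functional `cost`,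
with `m` the positive part of the Hamilton–Jacobi left-hand side. Convexity and the parallelogram
law give a strongly convergent minimising sequence, and Fatou's lemma shows that its limit is a
minimiser. -/

noncomputable section

namespace MFG

/-! ### The fundamental domain of the torus -/

/-- The representative in `[0, 1)` of a point of the torus. -/
def rep (x : Torus) : ℝ := (AddCircle.equivIco 1 0 x : ℝ)

lemma rep_mem (x : Torus) : rep x ∈ Ico (0 : ℝ) 1 := by
  have h := (AddCircle.equivIco 1 0 x).2
  exact ⟨h.1, h.2.trans_eq (zero_add 1)⟩

lemma coe_rep (x : Torus) : ((rep x : ℝ) : Torus) = x := AddCircle.coe_equivIco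

lemma rep_coe {t : ℝ} (ht : t ∈ Ico (0 : ℝ) 1) : rep (t : Torus) = t := by
  unfold rep
  rw [AddCircle.equivIco_coe_eq (by simpa using ht)]

lemma measurable_rep : Measurable rep :=
  measurable_subtype_coe.comp (AddCircle.measurableEquivIco 1 0).measurable

lemma measurePreserving_coe :
    MeasurePreserving ((↑) : ℝ → Torus) (volume.restrict (Ioc 0 1)) volume := by
  simpa using UnitAddCircle.measurePreserving_mk 0

lemma measurePreserving_rep : MeasurePreserving rep volume (volume.restrict (Ioc 0 1)) := by
  refine ⟨measurable_rep, ?_⟩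
  rw [← measurePreserving_coe.map_eq, Measure.map_map measurable_rep
    measurePreserving_coe.measurable]
  have h : rep ∘ ((↑) : ℝ → Torus) =ᵐ[volume.restrict (Ioc 0 1)] id := by
    rw [Filter.EventuallyEq, ae_restrict_iff' measurableSet_Ioc]
    have h1 : ∀ᵐ t : ℝ, t ≠ 1 := by simp [ae_iff, measure_singleton]
    filter_upwards [h1] with t h1 ht
    exact rep_coe ⟨ht.1.le, lt_of_le_of_ne ht.2 h1⟩
  rw [Measure.map_congr h, Measure.map_id]

lemma ae_torus_iff {P : Torus → Prop} :
    (∀ᵐ x, P x) ↔ ∀ᵐ t : ℝ, t ∈ Ioo (0 : ℝ) 1 → P t := by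
  have h1 : ∀ᵐ t : ℝ, t ≠ 1 := by simp [ae_iff, measure_singleton]
  constructor
  · intro h
    have := measurePreserving_coe.quasiMeasurePreserving.ae h
    rw [ae_restrict_iff' measurableSet_Ioc] at this
    filter_upwards [this] with t ht hm
    exact ht ⟨hm.1, hm.2.le⟩
  · intro h
    have h' : ∀ᵐ t : ℝ ∂(volume.restrict (Ioc (0 : ℝ) 1)), P (t : Torus) := by
      rw [ae_restrict_iff' measurableSet_Ioc]
      filter_upwards [h, h1] with t ht h1 hm
      exact ht ⟨hm.1, lt_of_le_of_ne hm.2 h1⟩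
    filter_upwards [measurePreserving_rep.quasiMeasurePreserving.ae h'] with x hx
    rwa [coe_rep] at hx

lemma integral_torus (f : Torus → ℝ) : ∫ x, f x = ∫ t in (0 : ℝ)..1, f t := by
  rw [← UnitAddCircle.intervalIntegral_preimage 0 f, zero_add]

instance : IsProbabilityMeasure (volume : Measure Torus) := ⟨UnitAddCircle.measure_univ⟩

lemma intervalIntegrable_coe {v : Torus → ℝ} (hv : Integrable v) :
    IntervalIntegrable (fun t : ℝ => v t) volume 0 1 := by
  rw [intervalIntegrable_iff_integrableOn_Ioc_of_le zero_le_one]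
  exact measurePreserving_coe.integrable_comp_of_integrable hv

lemma intervalIntegrable_coe_sub {v : Torus → ℝ} (hv : Integrable v) {a b : ℝ}
    (ha : a ∈ Icc (0 : ℝ) 1) (hb : b ∈ Icc (0 : ℝ) 1) :
    IntervalIntegrable (fun t : ℝ => v t) volume a b := by
  refine (intervalIntegrable_coe hv).mono_set ?_
  rw [uIcc_of_le zero_le_one]
  exact uIcc_subset_Icc ha hb

/-! ### Primitives of integrable functions -/

/-- The primitive `x ↦ ∫₀ˣ v` on the fundamental domain. -/
def prim (v : Torus → ℝ) (x : Torus) : ℝ := ∫ s in (0 : ℝ)..rep x, v s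

lemma prim_coe (v : Torus → ℝ) {t : ℝ} (ht : t ∈ Ico (0 : ℝ) 1) :
    prim v t = ∫ s in (0 : ℝ)..t, v s := by
  rw [prim, rep_coe ht]

lemma prim_eq_liftIco (v : Torus → ℝ) :
    prim v = AddCircle.liftIco 1 0 (fun t : ℝ => ∫ s in (0 : ℝ)..t, v s) := rfl

lemma continuousOn_primitive {v : Torus → ℝ} (hv : Integrable v) :
    ContinuousOn (fun t : ℝ => ∫ s in (0 : ℝ)..t, v s) (Icc 0 1) := by
  have := intervalIntegral.continuousOn_primitive_interval' (intervalIntegrable_coe hv)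
    (a := 0) (by simp)
  rwa [uIcc_of_le zero_le_one] at this

lemma measurable_prim {v : Torus → ℝ} (hv : Integrable v) : Measurable (prim v) := by
  have h := (continuousOn_primitive hv)
  rw [continuousOn_iff_continuous_domRestrict] at h
  have hr : Measurable (fun x : Torus =>
      (⟨rep x, Ico_subset_Icc_self (rep_mem x)⟩ : Icc (0:ℝ) 1)) :=
    measurable_rep.subtype_mk
  exact h.measurable.comp hr

/-- The zero mean makes the primitive match at the seam 0 = 1. -/
lemma continuous_prim {v : Torus → ℝ} (hv : Integrable v) (h0 : ∫ x, v x = 0) :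
    Continuous (prim v) := by
  rw [prim_eq_liftIco]
  refine AddCircle.liftIco_zero_continuous ?_ (continuousOn_primitive hv)
  rw [← integral_torus, h0, intervalIntegral.integral_same]

lemma abs_prim_le {v : Torus → ℝ} (hv : Integrable v) (x : Torus) : |prim v x| ≤ ∫ y, |v y| := by
  have hx := rep_mem x
  rw [integral_torus (fun y => |v y|)]
  refine (intervalIntegral.abs_integral_le_integral_abs hx.1).trans ?_
  refine intervalIntegral.integral_mono_interval le_rfl hx.1 hx.2.le ?_
    (intervalIntegrable_coe hv.abs)
  exact Eventually.of_forall fun t => abs_nonneg _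

lemma integrable_prim {v : Torus → ℝ} (hv : Integrable v) : Integrable (prim v) :=
  Integrable.of_bound (measurable_prim hv).aestronglyMeasurable (∫ y, |v y|)
    (Eventually.of_forall fun x => abs_prim_le hv x)

lemma prim_congr_ae {v w : Torus → ℝ} (h : v =ᵐ[volume] w) : prim v = prim w := by
  funext x
  have hx := rep_mem x
  refine intervalIntegral.integral_congr_ae ?_
  filter_upwards [ae_torus_iff.1 h] with t ht hm
  rw [uIoc_of_le hx.1] at hm
  exact ht ⟨hm.1, hm.2.trans_lt hx.2⟩

lemma prim_add {v w : Torus → ℝ} (hv : Integrable v) (hw : Integrable w) (x : Torus) :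
    prim (fun y => v y + w y) x = prim v x + prim w x := by
  have hx := Ico_subset_Icc_self (rep_mem x)
  exact intervalIntegral.integral_add (intervalIntegrable_coe_sub hv (by simp) hx)
    (intervalIntegrable_coe_sub hw (by simp) hx)

lemma prim_sub {v w : Torus → ℝ} (hv : Integrable v) (hw : Integrable w) (x : Torus) :
    prim (fun y => v y - w y) x = prim v x - prim w x := by
  have hx := Ico_subset_Icc_self (rep_mem x)
  exact intervalIntegral.integral_sub (intervalIntegrable_coe_sub hv (by simp) hx)
    (intervalIntegrable_coe_sub hw (by simp) hx)

lemma prim_const_mul (c : ℝ) (v : Torus → ℝ) (x : Torus) :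
    prim (fun y => c * v y) x = c * prim v x :=
  intervalIntegral.integral_const_mul _ _

/-- The product of two absolutely continuous primitives is integrated; by Lebesgue differentiation
their derivatives are `f` and `g` a.e. -/
lemma integral_primitive_mul_add {f g : ℝ → ℝ} {a b : ℝ}
    (hf : IntervalIntegrable f volume a b) (hg : IntervalIntegrable g volume a b) :
    ∫ t in a..b, f t * (∫ s in a..t, g s) + (∫ s in a..t, f s) * g t
      = (∫ t in a..b, f t) * ∫ t in a..b, g t := by
  have hF := hf.absolutelyContinuousOnInterval_intervalIntegral (c := a) (by simp)
  have hG := hg.absolutelyContinuousOnInterval_intervalIntegral (c := a) (by simp)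
  have h := hF.integral_deriv_mul_eq_sub hG
  simp only [intervalIntegral.integral_same, mul_zero, sub_zero] at h
  rw [← h]
  refine intervalIntegral.integral_congr_ae ?_
  filter_upwards [hf.ae_hasDerivAt_integral, hg.ae_hasDerivAt_integral] with t h1 h2 ht
  have ht' := uIoc_subset_uIcc ht
  rw [(h1 ht' a (by simp)).deriv, (h2 ht' a (by simp)).deriv]

lemma integrable_mul_of_bounded {f g : Torus → ℝ} (hf : Integrable f)
    (hg : AEStronglyMeasurable g) {C : ℝ} (hC : ∀ x, |g x| ≤ C) :
    Integrable (fun x => f x * g x) :=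
  hf.mul_bdd hg (Eventually.of_forall hC)

/-- Integration by parts on the torus for two absolutely continuous functions. -/
lemma integral_prim_mul_add {v w : Torus → ℝ} (hv : Integrable v) (hw : Integrable w)
    (hv0 : ∫ x, v x = 0) (hw0 : ∫ x, w x = 0) (c d : ℝ) :
    ∫ x, (c + prim v x) * w x = - ∫ x, v x * (d + prim w x) := by
  have i1 : Integrable (fun x => w x * prim v x) :=
    integrable_mul_of_bounded hw (measurable_prim hv).aestronglyMeasurable (abs_prim_le hv)
  have i2 : Integrable (fun x => v x * prim w x) :=
    integrable_mul_of_bounded hv (measurable_prim hw).aestronglyMeasurable (abs_prim_le hw)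
  have key : ∫ x, (v x * prim w x + w x * prim v x) = 0 := by
    have h := integral_primitive_mul_add (intervalIntegrable_coe hv) (intervalIntegrable_coe hw)
    rw [← integral_torus v, hv0, zero_mul] at h
    rw [integral_torus]
    refine Eq.trans ?_ h
    refine intervalIntegral.integral_congr_ae ?_
    have h1 : ∀ᵐ t : ℝ, t ≠ 1 := by simp [ae_iff, measure_singleton]
    filter_upwards [h1] with t h1 ht
    rw [uIoc_of_le zero_le_one] at ht
    have ht' : t ∈ Ico (0:ℝ) 1 := ⟨ht.1.le, lt_of_le_of_ne ht.2 h1⟩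
    rw [prim_coe _ ht', prim_coe _ ht']
    ring
  rw [integral_add i2 i1] at key
  have e1 : ∫ x, (c + prim v x) * w x = ∫ x, w x * prim v x := by
    have : ∀ x, (c + prim v x) * w x = c * w x + w x * prim v x := fun x => by ring
    simp_rw [this]
    rw [integral_add (hw.const_mul c) i1, integral_const_mul, hw0]; ring
  have e2 : ∫ x, v x * (d + prim w x) = ∫ x, v x * prim w x := by
    have : ∀ x, v x * (d + prim w x) = d * v x + v x * prim w x := fun x => by ring
    simp_rw [this]
    rw [integral_add (hv.const_mul d) i2, integral_const_mul, hv0]; ring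
  rw [e1, e2]; linarith

/-! ### Weak derivatives -/

lemma integrable_continuousMap (f : C(Torus, ℝ)) : Integrable (fun x => f x) :=
  f.continuous.integrable_of_hasCompactSupport (HasCompactSupport.of_compactSpace _)

lemma IsC1WithDeriv.eq_prim {ψ ψ' : C(Torus, ℝ)} (h : IsC1WithDeriv ψ ψ') :
    (∫ x, ψ' x = 0) ∧ ∀ x, ψ x = ψ ((0 : ℝ) : Torus) + prim (fun x => ψ' x) x := by
  have hft (a : ℝ) : ∫ s in (0:ℝ)..a, ψ' s = ψ (a : Torus) - ψ ((0 : ℝ) : Torus) :=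
    intervalIntegral.integral_eq_sub_of_hasDerivAt (fun t _ => h t)
      ((ψ'.continuous.comp (AddCircle.continuous_mk' 1)).intervalIntegrable _ _)
  refine ⟨?_, fun x => ?_⟩
  · rw [integral_torus, hft 1]
    have : ((1 : ℝ) : Torus) = ((0 : ℝ) : Torus) := by simp
    rw [this, sub_self]
  · rw [prim, hft, coe_rep]; ring

/-- The issue is differentiability at the integers, where `prim` is glued. Whole periods of `g`
integrate to zero, so the lift of `G` is an ordinary primitive on all of ℝ. -/
lemma isC1WithDeriv_prim {g G : C(Torus, ℝ)} (h0 : ∫ x, g x = 0) (c : ℝ)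
    (hG : ∀ x, G x = c + prim (fun x => g x) x) : IsC1WithDeriv G g := by
  have hg : Continuous fun t : ℝ => g (t : Torus) := g.continuous.comp (AddCircle.continuous_mk' 1)
  have hper : Function.Periodic (fun t : ℝ => g (t : Torus)) 1 := fun t => by simp
  have key : ∀ t : ℝ, G (t : Torus) = c + ∫ s in (0:ℝ)..t, g s := by
    intro t
    have e : ((Int.fract t : ℝ) : Torus) = (t : Torus) := by
      rw [← sub_eq_zero, ← AddCircle.coe_sub, ← neg_sub, Int.self_sub_fract]
      rw [AddCircle.coe_eq_zero_iff]
      exact ⟨-⌊t⌋, by simp⟩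
    have h1 : Int.fract t ∈ Ico (0:ℝ) 1 := ⟨Int.fract_nonneg t, Int.fract_lt_one t⟩
    rw [← e, hG, prim_coe _ h1]
    have h2 := hper.intervalIntegral_add_zsmul_eq ⌊t⌋ (Int.fract t)
      (fun _ _ => hg.intervalIntegrable _ _)
    have h3 : ∫ s in Int.fract t..Int.fract t + 1, g (s : Torus) = 0 := by
      rw [UnitAddCircle.intervalIntegral_preimage, h0]
    have h4 : Int.fract t + ⌊t⌋ • (1:ℝ) = t := by simp
    rw [h4] at h2
    have h5 : ∫ s in Int.fract t..t, g (s : Torus) = 0 := by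
      rw [h2, h3, smul_zero]
    rw [← intervalIntegral.integral_add_adjacent_intervals
      (hg.intervalIntegrable 0 (Int.fract t)) (hg.intervalIntegrable (Int.fract t) t), h5, add_zero]
  intro t
  have : (fun s : ℝ => G (s : Torus)) = fun s => c + ∫ r in (0:ℝ)..s, g r := funext key
  rw [this]
  exact (intervalIntegral.integral_hasDerivAt_right (hg.intervalIntegrable _ _)
    hg.stronglyMeasurable.stronglyMeasurableAtFilter hg.continuousAt).const_add c

lemma isWeakDeriv_prim {v : Torus → ℝ} (hv : Integrable v) (h0 : ∫ x, v x = 0) (c : ℝ) :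
    IsWeakDeriv (fun x => c + prim v x) v := by
  refine ⟨(integrable_const c).add (integrable_prim hv), hv, fun ψ ψ' h => ?_⟩
  obtain ⟨h1, h2⟩ := h.eq_prim
  rw [integral_prim_mul_add hv (integrable_continuousMap ψ') h0 h1 c (ψ ((0 : ℝ) : Torus))]
  simp_rw [← h2]

/-- Bump functions supported in (0, 1) descend to continuous functions on the torus, which reduces
the claim to the fundamental lemma on an interval. -/
lemma ae_eq_zero_of_integral_continuous_mul_eq_zero {f : Torus → ℝ} (hf : Integrable f)
    (h : ∀ g : C(Torus, ℝ), ∫ x, f x * g x = 0) : f =ᵐ[volume] 0 := by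
  rw [Filter.EventuallyEq, ae_torus_iff]
  refine isOpen_Ioo.ae_eq_zero_of_integral_contDiff_smul_eq_zero ?_ ?_
  · have := (intervalIntegrable_coe hf).1
    exact (this.mono_set Ioo_subset_Ioc_self).locallyIntegrableOn
  · intro g hg _ hsupp
    have h0 : ∀ t ∉ Ioo (0:ℝ) 1, g t = 0 := fun t ht => by
      by_contra hne
      exact ht (hsupp (subset_tsupport g hne))
    have hc : Continuous (AddCircle.liftIco 1 0 g : Torus → ℝ) :=
      AddCircle.liftIco_zero_continuous (by rw [h0 0 (by simp), h0 1 (by simp)])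
        hg.continuous.continuousOn
    have := h ⟨_, hc⟩
    rw [integral_torus, intervalIntegral.integral_of_le zero_le_one] at this
    rw [← this, ← setIntegral_eq_integral_of_forall_compl_eq_zero (s := Ioc (0:ℝ) 1)]
    · refine setIntegral_congr_fun measurableSet_Ioc fun t ht => ?_
      rcases ht.2.lt_or_eq with h1 | h1
      · have : AddCircle.liftIco 1 0 g (t : Torus) = g t :=
          AddCircle.liftIco_zero_coe_apply ⟨ht.1.le, h1⟩
        simp only [ContinuousMap.coe_mk, this, smul_eq_mul, mul_comm]
      · have e : (t : Torus) = ((0:ℝ) : Torus) := by rw [h1]; simp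
        have e' : AddCircle.liftIco 1 0 g (t : Torus) = g 0 := by
          rw [e]; exact AddCircle.liftIco_zero_coe_apply (by simp)
        have e0 : g t = 0 := h0 t (by simp [h1])
        simp only [ContinuousMap.coe_mk, e', smul_eq_mul, h0 0 (by simp), e0, zero_mul, mul_zero]
    · intro t ht
      rw [h0 t (fun h => ht ⟨h.1, h.2.le⟩), zero_smul]

lemma IsWeakDeriv.integral_eq_zero {u v : Torus → ℝ} (h : IsWeakDeriv u v) : ∫ x, v x = 0 := by
  have := h.2.2 (ContinuousMap.const _ 1) (ContinuousMap.const _ 0)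
    (fun t => by simpa using hasDerivAt_const t (1:ℝ))
  simpa using this

/-- A function with a weak derivative is a.e. equal to a primitive of it. -/
lemma IsWeakDeriv.exists_eq_prim {u v : Torus → ℝ} (h : IsWeakDeriv u v) :
    ∃ c, ∀ᵐ x, u x = c + prim v x := by
  have h0 := h.integral_eq_zero
  have hw := (isWeakDeriv_prim h.2.1 h0 0)
  have hi : Integrable (fun x => u x - prim v x) := h.1.sub (integrable_prim h.2.1)
  set c := ∫ x, (u x - prim v x) with hc
  refine ⟨c, ?_⟩
  have key : (fun x => u x - prim v x - c) =ᵐ[volume] 0 := by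
    refine ae_eq_zero_of_integral_continuous_mul_eq_zero (hi.sub (integrable_const c)) fun g => ?_
    -- Only mean-zero functions are derivatives of test functions. The mean of `g` does no harm
    -- because `u - prim v - c` has mean zero by the choice of `c`.
    set g₀ : C(Torus, ℝ) := g - ContinuousMap.const _ (∫ x, g x) with hg₀
    have hg0 : ∫ x, g₀ x = 0 := by
      simp only [hg₀, ContinuousMap.sub_apply, ContinuousMap.const_apply]
      rw [integral_sub (integrable_continuousMap g) (integrable_const _)]
      simp
    have hC1 := isC1WithDeriv_prim (g := g₀)
      (G := ⟨_, continuous_prim (integrable_continuousMap g₀) hg0⟩) hg0 0 (fun x => by simp)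
    have e1 := h.2.2 _ _ hC1
    have e2 := hw.2.2 _ _ hC1
    simp only [zero_add] at e2
    have bdd : ∃ C, ∀ x, |g₀ x| ≤ C := ⟨‖g₀‖, fun x => g₀.norm_coe_le_norm x⟩
    obtain ⟨C, hC⟩ := bdd
    have i1 := integrable_mul_of_bounded h.1 g₀.continuous.aestronglyMeasurable hC
    have i2 := integrable_mul_of_bounded (integrable_prim h.2.1)
      g₀.continuous.aestronglyMeasurable hC
    have e3 : ∫ x, (u x - prim v x) * g₀ x = 0 := by
      simp_rw [sub_mul]
      rw [integral_sub i1 i2, e1, e2, sub_self]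
    have : ∀ x, (u x - prim v x - c) * g x
        = (u x - prim v x) * g₀ x + (∫ y, g y) * (u x - prim v x - c) - c * g₀ x := by
      intro x
      simp only [hg₀, ContinuousMap.sub_apply, ContinuousMap.const_apply]; ring
    simp_rw [this]
    have i3 : Integrable (fun x => (u x - prim v x) * g₀ x) :=
      integrable_mul_of_bounded hi g₀.continuous.aestronglyMeasurable hC
    have i4 : Integrable (fun x => u x - prim v x - c) := hi.sub (integrable_const c)
    have e4 : ∫ x, (u x - prim v x - c) = 0 := by
      rw [integral_sub hi (integrable_const c)]; simp [← hc]
    have i5 : Integrable (fun x => (∫ y, g y) * (u x - prim v x - c)) := i4.const_mul _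
    have i6 : Integrable (fun x => (u x - prim v x) * g₀ x + (∫ y, g y) * (u x - prim v x - c)) :=
      i3.add i5
    rw [integral_sub i6 ((integrable_continuousMap g₀).const_mul c), integral_add i3 i5, e3,
      integral_const_mul, integral_const_mul, e4, hg0]
    simp
  filter_upwards [key] with x hx
  simp only [Pi.zero_apply] at hx
  linarith

/-- This allows the flux equation to be tested with `u` itself, which is only absolutely continuous,
without approximation by C¹ functions. -/
lemma IsWeakDeriv.integral_mul {u v J K : Torus → ℝ} (h : IsWeakDeriv u v)
    (h' : IsWeakDeriv J K) : ∫ x, u x * K x = - ∫ x, v x * J x := by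
  obtain ⟨c, hc⟩ := h.exists_eq_prim
  obtain ⟨d, hd⟩ := h'.exists_eq_prim
  have := integral_prim_mul_add h.2.1 h'.2.1 h.integral_eq_zero h'.integral_eq_zero c d
  rw [integral_congr_ae (g := fun x => (c + prim v x) * K x), this,
    integral_congr_ae (f := fun x => v x * J x)]
  · filter_upwards [hd] with x hx; rw [hx]
  · filter_upwards [hc] with x hx; rw [hx]

lemma IsWeakDeriv.sub {u v u' v' : Torus → ℝ} (h : IsWeakDeriv u v) (h' : IsWeakDeriv u' v') :
    IsWeakDeriv (fun x => u x - u' x) (fun x => v x - v' x) := by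
  refine ⟨h.1.sub h'.1, h.2.1.sub h'.2.1, fun ψ ψ' hψ => ?_⟩
  have i {f : Torus → ℝ} (hf : Integrable f) (g : C(Torus, ℝ)) :
      Integrable (fun x => f x * g x) :=
    integrable_mul_of_bounded hf g.continuous.aestronglyMeasurable (fun x => g.norm_coe_le_norm x)
  simp_rw [sub_mul]
  rw [integral_sub (i h.1 _) (i h'.1 _), integral_sub (i h.2.1 _) (i h'.2.1 _),
    h.2.2 _ _ hψ, h'.2.2 _ _ hψ]
  ring

/-- The derivative of an absolutely continuous function vanishes a.e. on a level set. -/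
lemma IsWeakDeriv.ae_eq_zero_of_eq_zero {J K : Torus → ℝ} (h : IsWeakDeriv J K) :
    ∀ᵐ x, J x = 0 → K x = 0 := by
  obtain ⟨d, hd⟩ := h.exists_eq_prim
  set F : ℝ → ℝ := fun t => d + ∫ s in (0:ℝ)..t, K s with hF
  -- Isolated zeros of `F` form a discrete subspace of the line, hence a countable null set; a zero
  -- at which the derivative is nonzero is isolated.
  have hcount : {t : ℝ | F t = 0 ∧ ∀ᶠ s in 𝓝[≠] t, F s ≠ 0}.Countable := by
    set S := {t : ℝ | F t = 0 ∧ ∀ᶠ s in 𝓝[≠] t, F s ≠ 0} with hS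
    have : DiscreteTopology S := by
      rw [discreteTopology_subtype_iff]
      intro t ht
      rw [← disjoint_iff, Filter.disjoint_principal_right]
      filter_upwards [ht.2] with s hs hs'
      exact hs hs'.1
    exact Set.countable_coe_iff.1 (TopologicalSpace.separableSpace_iff_countable.1 inferInstance)
  have hder := (intervalIntegrable_coe h.2.1).ae_hasDerivAt_integral
  have hnot := hcount.ae_notMem volume
  rw [ae_torus_iff] at hd ⊢
  filter_upwards [hd, hder, hnot] with t h1 h2 h3 ht hJ
  by_contra hne
  have ht' : t ∈ uIcc (0:ℝ) 1 := by rw [uIcc_of_le zero_le_one]; exact Ioo_subset_Icc_self ht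
  have h4 : HasDerivAt F (K t) t := (h2 ht' 0 (by simp)).const_add d
  refine h3 ⟨?_, h4.eventually_ne hne⟩
  rw [← hJ, h1 ht, prim_coe _ (Ioo_subset_Ico_self ht)]

/-! ### The potential and the ergodic density -/

lemma continuous_potentialReal : Continuous potentialReal := by
  unfold potentialReal
  refine Continuous.if_le (by fun_prop) (Continuous.if_le (by fun_prop)
    (Continuous.if_le (by fun_prop) (by fun_prop) (by fun_prop) (by fun_prop) ?_)
    (by fun_prop) (by fun_prop) ?_) (by fun_prop) (by fun_prop) ?_
  · intro x hx; subst hx; norm_num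
  · intro x hx; subst hx; norm_num
  · intro x hx; subst hx; norm_num

lemma W_eq (x : Torus) : W x = potentialReal (rep x) := rfl

lemma W_coe {t : ℝ} (ht : t ∈ Ico (0 : ℝ) 1) : W t = potentialReal t := by
  rw [W_eq, rep_coe ht]

lemma continuous_W : Continuous W :=
  AddCircle.liftIco_zero_continuous (by norm_num [potentialReal])
    continuous_potentialReal.continuousOn

lemma abs_W_le (x : Torus) : |W x| ≤ 4 := by
  have h := rep_mem x
  rw [W_eq, abs_le]
  unfold potentialReal
  split_ifs <;> constructor <;> linarith [h.1, h.2]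

lemma continuous_mErg : Continuous mErg := continuous_W.max continuous_const

lemma mErg_nonneg (x : Torus) : 0 ≤ mErg x := le_max_right _ _

lemma mErg_le (x : Torus) : mErg x ≤ 4 :=
  max_le (le_of_abs_le (abs_W_le x)) (by norm_num)

lemma mErg_coe {t : ℝ} (ht : t ∈ Icc (0 : ℝ) 1) : mErg t = max (potentialReal t) 0 := by
  rcases ht.2.lt_or_eq with h | h
  · rw [mErg, W_coe ⟨ht.1, h⟩]
  · have e : (t : Torus) = ((0:ℝ) : Torus) := by rw [h]; simp
    rw [mErg, e, W_coe (by simp), h]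
    norm_num [potentialReal]

lemma mErg_mul_W (x : Torus) : mErg x * W x = mErg x * mErg x := by
  unfold mErg
  rcases le_total (W x) 0 with h | h
  · simp [h]
  · simp [h]

lemma integrable_of_continuous {f : Torus → ℝ} (hf : Continuous f) : Integrable f :=
  integrable_continuousMap ⟨f, hf⟩

lemma memLp_of_continuous {f : Torus → ℝ} (hf : Continuous f) (p : ℝ≥0∞) : MemLp f p := by
  obtain ⟨C, hC⟩ : ∃ C, ∀ x, ‖f x‖ ≤ C :=
    ⟨_, fun x => (⟨f, hf⟩ : C(Torus, ℝ)).norm_coe_le_norm x⟩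
  exact MemLp.of_bound hf.aestronglyMeasurable C (Eventually.of_forall hC)

/-- On an interval where the positive part of the potential is affine, its integral is explicit. -/
lemma integral_mErg_of_affine {a b α β : ℝ} (ha : 0 ≤ a) (hab : a ≤ b) (hb : b ≤ 1)
    (h : ∀ t ∈ Icc a b, max (potentialReal t) 0 = α * t + β) :
    ∫ s in a..b, (mErg s - 1) = α * (b ^ 2 - a ^ 2) / 2 + (β - 1) * (b - a) := by
  have : ∫ s in a..b, (mErg s - 1) = ∫ s in a..b, (α * s + (β - 1)) := by
    refine intervalIntegral.integral_congr fun s hs => ?_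
    rw [uIcc_of_le hab] at hs
    rw [mErg_coe ⟨ha.trans hs.1, hs.2.trans hb⟩, h s hs]; ring
  rw [this, intervalIntegral.integral_add
    (Continuous.intervalIntegrable (by fun_prop) _ _)
    (Continuous.intervalIntegrable (by fun_prop) _ _),
    intervalIntegral.integral_const_mul, integral_id, intervalIntegral.integral_const]
  simp only [smul_eq_mul]; ring

lemma intervalIntegrable_mErg_sub_one (a b : ℝ) :
    IntervalIntegrable (fun s : ℝ => mErg s - 1) volume a b :=
  (((continuous_mErg.comp (AddCircle.continuous_mk' 1)).sub continuous_const)).intervalIntegrable _ _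

/-- The triangle of height 4 over [0, 1/8] has mass 1/4, and the density vanishes from there to 3/8.
The zero at `t = 1/4` is what selects `θ = 1/4`. -/
lemma integral_mErg_left {t : ℝ} (ht : t ∈ Icc (1 / 8 : ℝ) (3 / 8)) :
    ∫ s in (0:ℝ)..t, (mErg s - 1) = 1 / 4 - t := by
  have h1 := integral_mErg_of_affine (a := 0) (b := 1 / 8) (α := -32) (β := 4) (by norm_num)
    (by norm_num) (by norm_num) (fun t ht => by
      rw [potentialReal, if_pos (by linarith [ht.2]), max_eq_left (by linarith [ht.2])])
  have h2 := integral_mErg_of_affine (a := 1 / 8) (b := t) (α := 0) (β := 0) (by norm_num)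
    ht.1 (by linarith [ht.2]) (fun s hs => by
      rw [max_eq_right]
      · ring
      · unfold potentialReal; split_ifs <;> linarith [hs.1, hs.2, ht.1, ht.2])
  rw [← intervalIntegral.integral_add_adjacent_intervals
    (intervalIntegrable_mErg_sub_one 0 (1 / 8)) (intervalIntegrable_mErg_sub_one (1 / 8) t), h1, h2]
  ring

lemma integral_mErg_middle : ∫ s in (0:ℝ)..(5 / 8), (mErg s - 1) = 1 / 8 := by
  have h0 := integral_mErg_left (t := 3 / 8) (by constructor <;> norm_num)
  have h1 := integral_mErg_of_affine (a := 3 / 8) (b := 1 / 2) (α := 32) (β := -12) (by norm_num)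
    (by norm_num) (by norm_num) (fun t ht => by
      rw [potentialReal, if_neg (by linarith [ht.1]), if_pos (by linarith [ht.2]),
        max_eq_left (by linarith [ht.1])]; ring)
  have h2 := integral_mErg_of_affine (a := 1 / 2) (b := 5 / 8) (α := -32) (β := 20) (by norm_num)
    (by norm_num) (by norm_num) (fun t ht => by
      rw [max_eq_left] <;> unfold potentialReal <;> split_ifs <;> linarith [ht.1, ht.2])
  rw [← intervalIntegral.integral_add_adjacent_intervals
      (intervalIntegrable_mErg_sub_one 0 (1 / 2)) (intervalIntegrable_mErg_sub_one (1 / 2) (5 / 8)),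
    ← intervalIntegral.integral_add_adjacent_intervals
      (intervalIntegrable_mErg_sub_one 0 (3 / 8)) (intervalIntegrable_mErg_sub_one (3 / 8) (1 / 2)),
    h0, h1, h2]
  norm_num

/-- The mass to the left of 5/8 is 1/4 + 1/2, the second summand coming from the peak at 1/2. -/
lemma integral_mErg_right {t : ℝ} (ht : t ∈ Icc (5 / 8 : ℝ) (7 / 8)) :
    ∫ s in (0:ℝ)..t, (mErg s - 1) = 3 / 4 - t := by
  have h2 := integral_mErg_of_affine (a := 5 / 8) (b := t) (α := 0) (β := 0) (by norm_num)
    ht.1 (by linarith [ht.2]) (fun s hs => by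
      rw [max_eq_right]
      · ring
      · unfold potentialReal; split_ifs <;> linarith [hs.1, hs.2, ht.1, ht.2])
  rw [← intervalIntegral.integral_add_adjacent_intervals
    (intervalIntegrable_mErg_sub_one 0 (5 / 8)) (intervalIntegrable_mErg_sub_one (5 / 8) t),
    integral_mErg_middle, h2]
  ring

lemma integral_mErg_sub_one : ∫ x, (mErg x - 1) = 0 := by
  have h1 := integral_mErg_of_affine (a := 7 / 8) (b := 1) (α := 32) (β := -28) (by norm_num)
    (by norm_num) (by norm_num) (fun t ht => by
      rw [max_eq_left] <;> unfold potentialReal <;> split_ifs <;> linarith [ht.1, ht.2])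
  rw [integral_torus, ← intervalIntegral.integral_add_adjacent_intervals
    (intervalIntegrable_mErg_sub_one 0 (7 / 8)) (intervalIntegrable_mErg_sub_one (7 / 8) 1),
    integral_mErg_right (by constructor <;> norm_num), h1]
  norm_num

lemma integral_mErg : ∫ x, mErg x = 1 := by
  have := integral_mErg_sub_one
  rw [integral_sub (integrable_of_continuous continuous_mErg) (integrable_const _)] at this
  simp at this
  linarith

/-- The `C¹` function `x ↦ ∫₀ˣ (m - 1)`. -/
def excess : C(Torus, ℝ) :=
  ⟨prim (fun x => mErg x - 1), continuous_prim
    (integrable_of_continuous (continuous_mErg.sub continuous_const)) integral_mErg_sub_one⟩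

lemma isC1WithDeriv_excess :
    IsC1WithDeriv excess ⟨fun x => mErg x - 1, continuous_mErg.sub continuous_const⟩ :=
  isC1WithDeriv_prim integral_mErg_sub_one 0 (fun x => by simp [excess])

lemma excess_coe_left {t : ℝ} (ht : t ∈ Icc (1 / 8 : ℝ) (3 / 8)) : excess t = 1 / 4 - t := by
  have : excess t = prim (fun x => mErg x - 1) t := rfl
  rw [this, prim_coe _ ⟨by linarith [ht.1], by linarith [ht.2]⟩, integral_mErg_left ht]

lemma excess_coe_right {t : ℝ} (ht : t ∈ Icc (5 / 8 : ℝ) (7 / 8)) : excess t = 3 / 4 - t := by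
  have : excess t = prim (fun x => mErg x - 1) t := rfl
  rw [this, prim_coe _ ⟨by linarith [ht.1], by linarith [ht.2]⟩, integral_mErg_right ht]

/-- Since `mErg - 1` has mean zero, the criterion is `∫ u (mErg - 1)`; `excess` is an admissible
test function with derivative `mErg - 1`. The criterion thus becomes a linear functional of the
slope. -/
lemma criterion_eq {u v : Torus → ℝ} (h : IsWeakDeriv u v) :
    criterion u = - ∫ x, v x * excess x := by
  have hb : ∀ x, |mErg x - 1| ≤ 5 := fun x => by
    rw [abs_le]; constructor <;> linarith [mErg_nonneg x, mErg_le x]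
  have hmeas : AEStronglyMeasurable (fun x => mErg x - 1) volume :=
    (continuous_mErg.sub continuous_const).aestronglyMeasurable
  have e := h.2.2 _ _ isC1WithDeriv_excess
  simp only [ContinuousMap.coe_mk] at e
  rw [← e]
  have i1 : Integrable (fun x => u x * (mErg x - 1)) := integrable_mul_of_bounded h.1 hmeas hb
  have i2 : Integrable (fun x => mErg x - 1) :=
    integrable_of_continuous (continuous_mErg.sub continuous_const)
  have : ∀ x, bracket u x * mErg x
      = u x * (mErg x - 1) - (∫ y, u y) * (mErg x - 1) + (u x - ∫ y, u y) := fun x => by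
    simp only [bracket]; ring
  unfold criterion
  simp_rw [this]
  have i3 : Integrable (fun x => u x * (mErg x - 1) - (∫ y, u y) * (mErg x - 1)) :=
    i1.sub (i2.const_mul _)
  have i4 : Integrable (fun x => u x - ∫ y, u y) := h.1.sub (integrable_const _)
  rw [integral_add i3 i4, integral_sub i1 (i2.const_mul _),
    integral_const_mul, integral_mErg_sub_one, integral_sub h.1 (integrable_const _)]
  simp

/-! ### The slopes `u^θ_x` -/

/-- The slope `u^θ_x` as a function on the torus. -/
def slope (θ : ℝ) (x : Torus) : ℝ := slopeTheta θ (rep x)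

lemma slope_coe (θ : ℝ) {t : ℝ} (ht : t ∈ Ico (0 : ℝ) 1) : slope θ t = slopeTheta θ t := by
  rw [slope, rep_coe ht]

lemma uTheta_eq (θ C : ℝ) : uTheta θ C = fun x => C + prim (slope θ) x := by
  funext x
  have hx := rep_mem x
  have : uTheta θ C x = (∫ y in (0:ℝ)..rep x, slopeTheta θ y) + C := rfl
  rw [this, prim, add_comm]
  congr 1
  refine intervalIntegral.integral_congr fun s hs => ?_
  rw [uIcc_of_le hx.1] at hs
  rw [slope_coe θ ⟨hs.1, hs.2.trans_lt hx.2⟩]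

lemma measurable_slopeTheta (θ : ℝ) : Measurable (slopeTheta θ) := by
  unfold slopeTheta
  have h1 : Measurable fun x => Real.sqrt (2 * max (-potentialReal x) 0) :=
    ((continuous_potentialReal.neg.max continuous_const).const_mul 2).sqrt.measurable
  exact (h1.mul (measurable_const.indicator (measurableSet_Ioo.union measurableSet_Ioo))).sub
    (h1.mul (measurable_const.indicator (measurableSet_Ioo.union measurableSet_Ioo)))

lemma measurable_slope (θ : ℝ) : Measurable (slope θ) :=
  (measurable_slopeTheta θ).comp measurable_rep

lemma slopeTheta_eq_zero (θ : ℝ) {t : ℝ} (ht : 0 ≤ potentialReal t) : slopeTheta θ t = 0 := by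
  simp [slopeTheta, ht]

lemma mem_of_potentialReal_neg {t : ℝ} (h : potentialReal t < 0) :
    t ∈ Ioo (1 / 8 : ℝ) (3 / 8) ∪ Ioo (5 / 8 : ℝ) (7 / 8) := by
  unfold potentialReal at h
  simp only [mem_union, mem_Ioo]
  split_ifs at h
  · left; constructor <;> linarith
  · left; constructor <;> linarith
  · right; constructor <;> linarith
  · right; constructor <;> linarith

lemma slopeTheta_of_mem_plus {θ t : ℝ} (hθ : θ ∈ Icc (1 / 8 : ℝ) (3 / 8))
    (ht : t ∈ Ioo (1 / 8 : ℝ) θ ∪ Ioo (5 / 8 : ℝ) (1 - θ)) :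
    slopeTheta θ t = Real.sqrt (2 * max (-potentialReal t) 0) := by
  have h2 : t ∉ Ioo θ (3 / 8) ∪ Ioo (1 - θ) (7 / 8) := by
    simp only [mem_union, mem_Ioo, mem_Icc] at *
    grind
  rw [slopeTheta, indicator_of_mem ht, indicator_of_notMem h2]; ring

lemma slopeTheta_of_mem_minus {θ t : ℝ} (hθ : θ ∈ Icc (1 / 8 : ℝ) (3 / 8))
    (ht : t ∈ Ioo θ (3 / 8) ∪ Ioo (1 - θ) (7 / 8)) :
    slopeTheta θ t = -Real.sqrt (2 * max (-potentialReal t) 0) := by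
  have h2 : t ∉ Ioo (1 / 8 : ℝ) θ ∪ Ioo (5 / 8 : ℝ) (1 - θ) := by
    simp only [mem_union, mem_Ioo, mem_Icc] at *
    grind
  rw [slopeTheta, indicator_of_mem ht, indicator_of_notMem h2]; ring

/-- At θ and 1 - θ both indicators vanish although the potential may be negative there; hence the
two exclusions. -/
lemma slopeTheta_sq {θ t : ℝ} (hθ : θ ∈ Icc (1 / 8 : ℝ) (3 / 8)) (h1 : t ≠ θ) (h2 : t ≠ 1 - θ) :
    slopeTheta θ t ^ 2 = 2 * max (-potentialReal t) 0 := by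
  rcases le_or_gt 0 (potentialReal t) with h | h
  · rw [slopeTheta_eq_zero θ h, max_eq_right (by linarith)]; ring
  · have hs : 0 ≤ 2 * max (-potentialReal t) 0 := by positivity
    have hm := mem_of_potentialReal_neg h
    by_cases ht : t ∈ Ioo (1 / 8 : ℝ) θ ∪ Ioo (5 / 8 : ℝ) (1 - θ)
    · rw [slopeTheta_of_mem_plus hθ ht, Real.sq_sqrt hs]
    · have ht' : t ∈ Ioo θ (3 / 8) ∪ Ioo (1 - θ) (7 / 8) := by
        simp only [mem_union, mem_Ioo, mem_Icc] at *
        grind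
      rw [slopeTheta_of_mem_minus hθ ht', neg_sq, Real.sq_sqrt hs]

/-- Density and slope live on disjoint sets, so the ergodic flux vanishes identically. This
degeneracy is the source of non-uniqueness in the ergodic problem. -/
lemma mErg_mul_slope (θ : ℝ) (x : Torus) : mErg x * slope θ x = 0 := by
  rcases le_or_gt 0 (potentialReal (rep x)) with h | h
  · rw [slope, slopeTheta_eq_zero θ h, mul_zero]
  · rw [mErg, W_eq, max_eq_right h.le, zero_mul]

lemma ae_slope_sq {θ : ℝ} (hθ : θ ∈ Icc (1 / 8 : ℝ) (3 / 8)) :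
    ∀ᵐ x, slope θ x ^ 2 = 2 * (mErg x - W x) := by
  rw [ae_torus_iff]
  have h (a : ℝ) : ∀ᵐ t : ℝ, t ≠ a := by simp [ae_iff, measure_singleton]
  filter_upwards [h θ, h (1 - θ)] with t h1 h2 ht
  have ht' := Ioo_subset_Ico_self ht
  rw [slope_coe θ ht', slopeTheta_sq hθ h1 h2, mErg, W_coe ht']
  rcases le_total 0 (potentialReal t) with h | h
  · rw [max_eq_left h, max_eq_right (by linarith)]; ring
  · rw [max_eq_right h, max_eq_left (by linarith)]; ring

lemma abs_slopeTheta_le (θ t : ℝ) : |slopeTheta θ t| ≤ Real.sqrt (2 * max (-potentialReal t) 0) +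
    Real.sqrt (2 * max (-potentialReal t) 0) := by
  have hs := Real.sqrt_nonneg (2 * max (-potentialReal t) 0)
  have hi (s : Set ℝ) : |s.indicator (fun _ => (1:ℝ)) t| ≤ 1 := by
    by_cases h : t ∈ s <;> simp [h]
  unfold slopeTheta
  refine (abs_sub _ _).trans ?_
  rw [abs_mul, abs_mul, abs_of_nonneg hs]
  gcongr <;> exact mul_le_of_le_one_right hs (hi _)

/-- The root is at most √8 ≤ 3 and is counted twice, which avoids any hypothesis on θ. -/
lemma abs_slope_le (θ : ℝ) (x : Torus) : |slope θ x| ≤ 6 := by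
  refine (abs_slopeTheta_le θ (rep x)).trans ?_
  have h : Real.sqrt (2 * max (-potentialReal (rep x)) 0) ≤ 3 := by
    rw [← W_eq]
    refine Real.sqrt_le_iff.2 ⟨by norm_num, ?_⟩
    have : max (-W x) 0 ≤ 4 := max_le (neg_le.1 (abs_le.1 (abs_W_le x)).1) (by norm_num)
    linarith
  linarith

lemma memLp_slope (θ : ℝ) (p : ℝ≥0∞) : MemLp (slope θ) p :=
  MemLp.of_bound (measurable_slope θ).aestronglyMeasurable 6
    (Eventually.of_forall (abs_slope_le θ))

lemma integrable_slope (θ : ℝ) : Integrable (slope θ) :=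
  memLp_one_iff_integrable.1 (memLp_slope θ 1)

/-- The reflection preserves the potential and exchanges (1/8, θ) with (1 - θ, 7/8) and (θ, 3/8)
with (5/8, 1 - θ). This oddness gives the slope mean zero, so that `u^θ` closes up on the torus. -/
lemma slopeTheta_one_sub (θ t : ℝ) : slopeTheta θ (1 - t) = - slopeTheta θ t := by
  have hW : potentialReal (1 - t) = potentialReal t := by
    unfold potentialReal; split_ifs <;> linarith
  have h1 : (Ioo (1 / 8) θ ∪ Ioo (5 / 8) (1 - θ)).indicator (fun _ => (1 : ℝ)) (1 - t)
      = (Ioo θ (3 / 8) ∪ Ioo (1 - θ) (7 / 8)).indicator (fun _ => (1 : ℝ)) t := by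
    simp only [indicator, mem_union, mem_Ioo]
    congr 1
    grind
  have h2 : (Ioo θ (3 / 8) ∪ Ioo (1 - θ) (7 / 8)).indicator (fun _ => (1 : ℝ)) (1 - t)
      = (Ioo (1 / 8) θ ∪ Ioo (5 / 8) (1 - θ)).indicator (fun _ => (1 : ℝ)) t := by
    simp only [indicator, mem_union, mem_Ioo]
    congr 1
    grind
  rw [slopeTheta, hW, h1, h2, slopeTheta]; ring

lemma integral_slope (θ : ℝ) : ∫ x, slope θ x = 0 := by
  have e : ∫ x, slope θ x = ∫ t in (0:ℝ)..1, slopeTheta θ t := by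
    rw [integral_torus]
    refine intervalIntegral.integral_congr_ae ?_
    have h1 : ∀ᵐ t : ℝ, t ≠ 1 := by simp [ae_iff, measure_singleton]
    filter_upwards [h1] with t h1 ht
    rw [uIoc_of_le zero_le_one] at ht
    exact slope_coe θ ⟨ht.1.le, lt_of_le_of_ne ht.2 h1⟩
  have h := intervalIntegral.integral_comp_sub_left (a := 0) (b := 1) (slopeTheta θ) 1
  simp only [slopeTheta_one_sub, intervalIntegral.integral_neg, sub_self, sub_zero] at h
  rw [e]; linarith

lemma isWeakDeriv_uTheta (θ C : ℝ) : IsWeakDeriv (uTheta θ C) (slope θ) := by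
  rw [uTheta_eq]
  exact isWeakDeriv_prim (integrable_slope θ) (integral_slope θ) C

lemma continuous_uTheta (θ C : ℝ) : Continuous (uTheta θ C) := by
  rw [uTheta_eq]
  exact continuous_const.add (continuous_prim (integrable_slope θ) (integral_slope θ))

lemma integral_uTilde : ∫ x, uTilde x = 0 := by
  have hi := integrable_prim (integrable_slope (1 / 4))
  unfold uTilde
  simp only [uTheta_eq]
  rw [integral_add (integrable_const _) hi, integral_add (integrable_const _) hi]
  simp

lemma deriv_ham (x : Torus) (p : ℝ) : deriv (ham x) p = p := by
  have : ham x = fun p => p ^ 2 / 2 + W x := by funext p; rw [ham, sq_abs]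
  rw [this]
  simp

lemma ham_eq (x : Torus) (p : ℝ) : ham x p = p ^ 2 / 2 + W x := by rw [ham, sq_abs]

/-! ### The ergodic problem -/

lemma ergodicSol_uTheta {θ : ℝ} (hθ : θ ∈ Icc (1 / 8 : ℝ) (3 / 8)) (C : ℝ) :
    ErgodicSol (uTheta θ C) mErg 0 := by
  refine ⟨slope θ, ⟨memLp_of_continuous (continuous_uTheta θ C) 4, memLp_slope θ 4,
    isWeakDeriv_uTheta θ C⟩, memLp_of_continuous continuous_mErg 2,
    Eventually.of_forall mErg_nonneg, integral_mErg, ?_, ?_, ?_, ?_⟩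
  · simp [deriv_ham, mErg_mul_slope]
  · filter_upwards [ae_slope_sq hθ] with x hx _
    rw [ham_eq, hx, coupling]; ring
  · filter_upwards [ae_slope_sq hθ] with x hx
    rw [ham_eq, hx, coupling]; linarith
  · intro ψ ψ' _
    simp [deriv_ham, mErg_mul_slope]

/-- If θ < θ', the two slopes have opposite nonzero values on (θ, θ'), while the derivative of the
vanishing difference is zero a.e.; so that interval would be null. The reverse inequality follows by
symmetry. -/
lemma uTheta_le_of_ae_eq {θ θ' C C' : ℝ} (hθ : θ ∈ Icc (1 / 8 : ℝ) (3 / 8))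
    (hθ' : θ' ∈ Icc (1 / 8 : ℝ) (3 / 8)) (h : uTheta θ C =ᵐ[volume] uTheta θ' C') :
    θ' ≤ θ := by
  by_contra hlt
  push Not at hlt
  have h0 := ((isWeakDeriv_uTheta θ C).sub (isWeakDeriv_uTheta θ' C')).ae_eq_zero_of_eq_zero
  have hnull : ∀ᵐ t : ℝ, t ∉ Ioo θ θ' := by
    filter_upwards [ae_torus_iff.1 h0, ae_torus_iff.1 h] with t h1 h2 ht
    have hlo : 1 / 8 < t := hθ.1.trans_lt ht.1
    have hhi : t < 3 / 8 := ht.2.trans_le hθ'.2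
    have hm : t ∈ Ioo (0:ℝ) 1 := ⟨by linarith, by linarith⟩
    have h3 := h1 hm (sub_eq_zero.2 (h2 hm))
    rw [slope_coe _ (Ioo_subset_Ico_self hm), slope_coe _ (Ioo_subset_Ico_self hm),
      slopeTheta_of_mem_minus hθ (Or.inl ⟨ht.1, hhi⟩),
      slopeTheta_of_mem_plus hθ' (Or.inl ⟨hlo, ht.2⟩)] at h3
    have hneg : potentialReal t < 0 := by
      unfold potentialReal; split_ifs <;> linarith
    have : 0 < Real.sqrt (2 * max (-potentialReal t) 0) := by
      refine Real.sqrt_pos.2 ?_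
      rw [max_eq_left (by linarith)]; linarith
    linarith
  have hv : volume (Ioo θ θ') = 0 := by
    exact measure_eq_zero_iff_ae_notMem.2 hnull
  rw [Real.volume_Ioo, ENNReal.ofReal_eq_zero] at hv
  linarith

/-- Slope and excess change sign together, from plus to minus, at 1/4 and at 3/4; elsewhere in {W ≥
0} the slope is zero. This alignment is special to θ = 1/4. -/
lemma abs_slope_mul_abs_excess (x : Torus) :
    slope (1 / 4) x * excess x = |slope (1 / 4) x| * |excess x| := by
  rw [← abs_mul, eq_comm, abs_eq_self]
  have key : ∀ t ∈ Ico (0:ℝ) 1, 0 ≤ slope (1 / 4) t * excess t := by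
    intro t ht
    rw [slope_coe _ ht]
    rcases le_or_gt 0 (potentialReal t) with h | h
    · rw [slopeTheta_eq_zero _ h, zero_mul]
    have hθ : (1 / 4 : ℝ) ∈ Icc (1 / 8 : ℝ) (3 / 8) := by constructor <;> norm_num
    have hs := Real.sqrt_nonneg (2 * max (-potentialReal t) 0)
    rcases mem_of_potentialReal_neg h with hm | hm
    · rw [excess_coe_left (Ioo_subset_Icc_self hm)]
      rcases lt_trichotomy t (1 / 4) with h1 | h1 | h1
      · rw [slopeTheta_of_mem_plus hθ (Or.inl ⟨hm.1, h1⟩)]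
        exact mul_nonneg hs (by linarith)
      · rw [h1]; simp
      · rw [slopeTheta_of_mem_minus hθ (Or.inl ⟨h1, hm.2⟩)]
        exact mul_nonneg_of_nonpos_of_nonpos (by linarith) (by linarith)
    · rw [excess_coe_right (Ioo_subset_Icc_self hm)]
      rcases lt_trichotomy t (3 / 4) with h1 | h1 | h1
      · rw [slopeTheta_of_mem_plus hθ (Or.inr ⟨hm.1, by linarith⟩)]
        exact mul_nonneg hs (by linarith)
      · rw [h1]; simp
      · rw [slopeTheta_of_mem_minus hθ (Or.inr ⟨by linarith, hm.2⟩)]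
        exact mul_nonneg_of_nonpos_of_nonpos (by linarith) (by linarith)
  simpa [coe_rep] using key (rep x) (rep_mem x)

lemma ae_excess_ne_zero : ∀ᵐ x, slope (1 / 4) x ≠ 0 → excess x ≠ 0 := by
  rw [ae_torus_iff]
  have h (a : ℝ) : ∀ᵐ t : ℝ, t ≠ a := by simp [ae_iff, measure_singleton]
  filter_upwards [h (1 / 4), h (3 / 4)] with t h1 h2 ht hq
  rw [slope_coe _ (Ioo_subset_Ico_self ht)] at hq
  have hneg : potentialReal t < 0 := by
    by_contra hn
    exact hq (slopeTheta_eq_zero _ (not_lt.1 hn))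
  rcases mem_of_potentialReal_neg hneg with hm | hm
  · rw [excess_coe_left (Ioo_subset_Icc_self hm)]
    exact sub_ne_zero.2 h1.symm
  · rw [excess_coe_right (Ioo_subset_Icc_self hm)]
    exact sub_ne_zero.2 h2.symm

lemma quarter_mem : (1 / 4 : ℝ) ∈ Icc (1 / 8 : ℝ) (3 / 8) := by constructor <;> norm_num

lemma isWeakDeriv_uTilde : IsWeakDeriv uTilde (slope (1 / 4)) := isWeakDeriv_uTheta _ _

lemma uTilde_mem_admissible : uTilde ∈ admissible := ergodicSol_uTheta quarter_mem _

/-- The Hamilton–Jacobi inequality with constant 0 reads `v² ≤ 2 (mErg - W)`, and `ũ` attains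
equality a.e. -/
lemma exists_deriv_of_mem_admissible {u : Torus → ℝ} (hu : u ∈ admissible) :
    ∃ v, IsWeakDeriv u v ∧ ∀ᵐ x, |v x| ≤ |slope (1 / 4) x| := by
  obtain ⟨v, ⟨-, -, hw⟩, -, -, -, -, -, hle, -⟩ := hu
  refine ⟨v, hw, ?_⟩
  filter_upwards [hle, ae_slope_sq quarter_mem] with x h1 h2
  rw [ham_eq, coupling] at h1
  refine sq_le_sq.1 ?_
  linarith

lemma integrable_mul_excess {v : Torus → ℝ} (hv : Integrable v) :
    Integrable (fun x => v x * excess x) :=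
  integrable_mul_of_bounded hv excess.continuous.aestronglyMeasurable
    (fun x => excess.norm_coe_le_norm x)

lemma criterion_sub_eq {u v : Torus → ℝ} (hw : IsWeakDeriv u v) :
    criterion u - criterion uTilde
      = ∫ x, (|slope (1 / 4) x| * |excess x| - v x * excess x) := by
  rw [criterion_eq hw, criterion_eq isWeakDeriv_uTilde]
  simp_rw [← abs_slope_mul_abs_excess]
  rw [integral_sub (integrable_mul_excess (integrable_slope _)) (integrable_mul_excess hw.2.1)]
  ring

lemma criterion_integrand_nonneg {a b g : ℝ} (h : |a| ≤ |b|) : 0 ≤ |b| * |g| - a * g := by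
  have := (le_abs_self (a * g)).trans_eq (abs_mul a g)
  have h2 := mul_le_mul_of_nonneg_right h (abs_nonneg g)
  linarith

lemma isMinOn_criterion_uTilde : IsMinOn criterion admissible uTilde := by
  intro u hu
  obtain ⟨v, hw, hle⟩ := exists_deriv_of_mem_admissible hu
  have : 0 ≤ criterion u - criterion uTilde := by
    rw [criterion_sub_eq hw]
    refine integral_nonneg_of_ae ?_
    filter_upwards [hle] with x hx
    exact criterion_integrand_nonneg hx
  exact sub_nonneg.1 this

/-- The nonnegative integrand of `criterion_sub_eq` has integral zero. It determines `v` wherever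
the excess is nonzero, and where the slope of `ũ` vanishes so does `v`. -/
lemma eq_uTilde_of_isMinOn {u : Torus → ℝ} (hu : u ∈ admissible)
    (hmin : IsMinOn criterion admissible u) : ∃ c : ℝ, u =ᵐ[volume] fun x => uTilde x + c := by
  obtain ⟨v, hw, hle⟩ := exists_deriv_of_mem_admissible hu
  have h1 : criterion u - criterion uTilde = 0 :=
    le_antisymm (sub_nonpos.2 (hmin uTilde_mem_admissible))
      (sub_nonneg.2 (isMinOn_criterion_uTilde hu))
  have hi : Integrable (fun x => |slope (1 / 4) x| * |excess x| - v x * excess x) := by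
    simp_rw [← abs_slope_mul_abs_excess]
    exact (integrable_mul_excess (integrable_slope _)).sub (integrable_mul_excess hw.2.1)
  rw [criterion_sub_eq hw, integral_eq_zero_iff_of_nonneg_ae ?_ hi] at h1
  · have hv : v =ᵐ[volume] slope (1 / 4) := by
      filter_upwards [h1, hle, ae_excess_ne_zero] with x h1 h2 h3
      by_cases hq : slope (1 / 4) x = 0
      · rw [hq, abs_zero] at h2
        rw [hq]; exact abs_nonpos_iff.1 h2
      · simp only [Pi.zero_apply] at h1
        rw [← abs_slope_mul_abs_excess, ← sub_mul] at h1
        have := (mul_eq_zero.1 h1).resolve_right (h3 hq)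
        linarith
    obtain ⟨c, hc⟩ := hw.exists_eq_prim
    obtain ⟨d, hd⟩ := isWeakDeriv_uTilde.exists_eq_prim
    refine ⟨c - d, ?_⟩
    filter_upwards [hc, hd] with x h1 h2
    rw [h1, h2, prim_congr_ae hv]; ring
  · filter_upwards [hle] with x hx
    exact criterion_integrand_nonneg hx

/-! ### Integrability and elementary integral inequalities -/

lemma memLp_mul_of_memLp_four {f g : Torus → ℝ} (hf : MemLp f 4) (hg : MemLp g 4) :
    MemLp (fun x => f x * g x) 2 := by
  have : ENNReal.HolderTriple 4 4 2 := ⟨by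
    have h : (4 : ℝ≥0∞) = 2 * 2 := by norm_num
    rw [h, ENNReal.mul_inv (by simp) (by simp), ← mul_add, ENNReal.inv_two_add_inv_two, mul_one]⟩
  exact hg.mul' hf

lemma memLp_two_of_memLp_four {f : Torus → ℝ} (hf : MemLp f 4) : MemLp f 2 :=
  hf.mono_exponent (by norm_num)

lemma integrable_mul_of_memLp_two {f g : Torus → ℝ} (hf : MemLp f 2) (hg : MemLp g 2) :
    Integrable (fun x => f x * g x) :=
  hf.integrable_mul hg

/-- Young's inequality with a free scale `s` replaces Cauchy–Schwarz: if `∫ f²` is of order `s²`,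
the bound is of order `s`. -/
lemma integral_abs_le_of_sq {f : Torus → ℝ} (hf : MemLp f 2) {s : ℝ} (hs : 0 < s) :
    ∫ x, |f x| ≤ s / 2 + (∫ x, f x ^ 2) / (2 * s) := by
  have h1 : ∀ x, |f x| ≤ s / 2 + (1 / (2 * s)) * f x ^ 2 := fun x => by
    have h : s / 2 + (1 / (2 * s)) * f x ^ 2 - |f x| = (|f x| - s) ^ 2 / (2 * s) := by
      rw [← sq_abs (f x)]; field_simp; ring
    have : 0 ≤ (|f x| - s) ^ 2 / (2 * s) := by positivity
    linarith
  have i2 : Integrable (fun x => (1 / (2 * s)) * f x ^ 2) := hf.integrable_sq.const_mul _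
  have := integral_mono (hf.integrable (by norm_num)).abs ((integrable_const (s / 2)).add i2) h1
  refine this.trans_eq ?_
  simp only [Pi.add_apply]
  rw [integral_add (integrable_const _) i2, integral_const_mul]
  simp
  ring

lemma abs_integral_le_const {f : Torus → ℝ} {C : ℝ} (h : ∀ᵐ x, |f x| ≤ C) :
    |∫ x, f x| ≤ C := by
  have := norm_integral_le_of_norm_le_const (μ := (volume : Measure Torus)) (f := f) h
  simpa using this

lemma abs_sub_integral_prim_le {v : Torus → ℝ} (hv : Integrable v) (x : Torus) :
    |prim v x - ∫ y, prim v y| ≤ 2 * ∫ y, |v y| := by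
  have h1 := abs_prim_le hv x
  have h2 := abs_integral_le_const (Eventually.of_forall (abs_prim_le hv))
  have := abs_sub (prim v x) (∫ y, prim v y)
  linarith

lemma IsWeakDeriv.ae_abs_sub_integral_le {u v : Torus → ℝ} (h : IsWeakDeriv u v) :
    ∀ᵐ x, |u x - ∫ y, u y| ≤ 2 * ∫ y, |v y| := by
  obtain ⟨c, hc⟩ := h.exists_eq_prim
  have e : ∫ y, u y = c + ∫ y, prim v y := by
    rw [integral_congr_ae hc, integral_add (integrable_const _) (integrable_prim h.2.1)]
    simp
  filter_upwards [hc] with x hx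
  rw [e, hx, add_sub_add_left_eq_sub]
  exact abs_sub_integral_prim_le h.2.1 x

/-! ### The discount problem: uniqueness -/

/-- A weak solution of the discount problem together with the derivative of its value function,
the Hamilton--Jacobi equation holding almost everywhere. -/
structure DiscountData (ε : ℝ) (u v m : Torus → ℝ) : Prop where
  weakDeriv : IsWeakDeriv u v
  memLp_u : MemLp u 4
  memLp_v : MemLp v 4
  memLp_m : MemLp m 2
  pos : ∀ᵐ x, 0 < m x
  integral_m : ∫ x, m x = 1
  hj : ∀ᵐ x, m x = ε * u x + v x ^ 2 / 2 + W x
  flux : IsWeakDeriv (fun x => m x * v x) (fun x => ε * (m x - 1))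

lemma DiscountSol.exists_data {ε : ℝ} (hε : 0 < ε) {u m : Torus → ℝ} (h : DiscountSol ε u m) :
    ∃ v, DiscountData ε u v m := by
  obtain ⟨v, ⟨hu, hv, hw⟩, hm, hm0, hm1, hJ, heq, -, hFP⟩ := h
  simp only [deriv_ham] at hJ hFP
  have him : Integrable m := hm.integrable (by norm_num)
  have hflux : IsWeakDeriv (fun x => m x * v x) (fun x => ε * (m x - 1)) := by
    refine ⟨hJ, (him.sub (integrable_const 1)).const_mul ε, fun ψ ψ' hψ => ?_⟩
    have h1 := hFP ψ ψ' hψ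
    have i1 : Integrable (fun x => m x * ψ x) :=
      integrable_mul_of_bounded him ψ.continuous.aestronglyMeasurable
        (fun x => ψ.norm_coe_le_norm x)
    have e : ∀ x, ε * (m x - 1) * ψ x = ε * (m x * ψ x) - ε * ψ x := fun x => by ring
    simp_rw [e]
    rw [integral_sub (i1.const_mul ε) ((integrable_continuousMap ψ).const_mul ε),
      integral_const_mul, integral_const_mul]
    linarith
  -- Where `m = 0` the flux `m v` vanishes, so a.e. there its derivative `ε (m - 1) = -ε` vanishes
  -- too: the set is null.
  have hpos : ∀ᵐ x, 0 < m x := by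
    filter_upwards [hm0, hflux.ae_eq_zero_of_eq_zero] with x h1 h2
    refine lt_of_le_of_ne h1 fun h0 => ?_
    have := h2 (by rw [← h0, zero_mul])
    rw [← h0] at this
    linarith
  refine ⟨v, hw, hu, hv, hm, hpos, hm1, ?_, hflux⟩
  filter_upwards [heq, hpos] with x h1 h2
  have := h1 h2
  rw [ham_eq, coupling] at this
  linarith

/-- The Lasry--Lions monotonicity identity for two pairs solving first-order mean field game
equations with right-hand sides `g` and `K`. -/
lemma monotonicity_identity {u₁ v₁ m₁ g₁ K₁ u₂ v₂ m₂ g₂ K₂ : Torus → ℝ}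
    (hu₁ : IsWeakDeriv u₁ v₁) (hv₁ : MemLp v₁ 4) (hm₁ : MemLp m₁ 2) (hg₁ : MemLp g₁ 2)
    (e₁ : ∀ᵐ x, m₁ x = g₁ x + v₁ x ^ 2 / 2 + W x) (f₁ : IsWeakDeriv (fun x => m₁ x * v₁ x) K₁)
    (hu₂ : IsWeakDeriv u₂ v₂) (hv₂ : MemLp v₂ 4) (hm₂ : MemLp m₂ 2) (hg₂ : MemLp g₂ 2)
    (e₂ : ∀ᵐ x, m₂ x = g₂ x + v₂ x ^ 2 / 2 + W x) (f₂ : IsWeakDeriv (fun x => m₂ x * v₂ x) K₂) :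
    ∫ x, ((m₁ x - m₂ x) ^ 2 + (m₁ x + m₂ x) * (v₁ x - v₂ x) ^ 2 / 2)
      = (∫ x, (g₁ x - g₂ x) * (m₁ x - m₂ x)) - ∫ x, (u₁ x - u₂ x) * (K₁ x - K₂ x) := by
  rw [(hu₁.sub hu₂).integral_mul (f₁.sub f₂), sub_neg_eq_add]
  have i1 : Integrable (fun x => (g₁ x - g₂ x) * (m₁ x - m₂ x)) :=
    integrable_mul_of_memLp_two (hg₁.sub hg₂) (hm₁.sub hm₂)
  have hdv : MemLp (fun x => v₁ x - v₂ x) 4 := hv₁.sub hv₂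
  have i2 : Integrable (fun x => (v₁ x - v₂ x) * (m₁ x * v₁ x - m₂ x * v₂ x)) := by
    have a1 := integrable_mul_of_memLp_two hm₁ (memLp_mul_of_memLp_four hdv hv₁)
    have a2 := integrable_mul_of_memLp_two hm₂ (memLp_mul_of_memLp_four hdv hv₂)
    refine (a1.sub a2).congr (Eventually.of_forall fun x => ?_)
    simp only [Pi.sub_apply]; ring
  rw [← integral_add i1 i2]
  refine integral_congr_ae ?_
  filter_upwards [e₁, e₂] with x h1 h2
  -- With `g₁ - g₂` eliminated by the Hamilton–Jacobi equations, a polynomial identity in `m` and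
  -- `v` remains.
  have hg : g₁ x - g₂ x = (m₁ x - m₂ x) - (v₁ x ^ 2 - v₂ x ^ 2) / 2 := by linarith
  rw [hg]; ring

lemma integrable_monotonicity {v₁ m₁ v₂ m₂ : Torus → ℝ}
    (hv₁ : MemLp v₁ 4) (hm₁ : MemLp m₁ 2) (hv₂ : MemLp v₂ 4) (hm₂ : MemLp m₂ 2) :
    Integrable (fun x => (m₁ x - m₂ x) ^ 2) ∧
      Integrable (fun x => (m₁ x + m₂ x) * (v₁ x - v₂ x) ^ 2 / 2) := by
  refine ⟨(hm₁.sub hm₂).integrable_sq, ?_⟩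
  have hdv : MemLp (fun x => v₁ x - v₂ x) 4 := hv₁.sub hv₂
  have := (integrable_mul_of_memLp_two (hm₁.add hm₂)
    (memLp_mul_of_memLp_four hdv hdv)).div_const 2
  refine this.congr (Eventually.of_forall fun x => ?_)
  simp only [Pi.add_apply]; ring

/-- Both terms on the right of the monotonicity identity equal `ε ∫ (u - u') (m - m')`. Positivity
of the densities then gives equal densities and slopes, and as ε > 0 the Hamilton–Jacobi equation
recovers `u` without a free constant. -/
lemma DiscountData.unique {ε : ℝ} (hε : 0 < ε) {u v m u' v' m' : Torus → ℝ}
    (h : DiscountData ε u v m) (h' : DiscountData ε u' v' m') :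
    u =ᵐ[volume] u' ∧ m =ᵐ[volume] m' := by
  have key := monotonicity_identity h.weakDeriv h.memLp_v h.memLp_m
    ((memLp_two_of_memLp_four h.memLp_u).const_mul ε) h.hj h.flux h'.weakDeriv h'.memLp_v
    h'.memLp_m ((memLp_two_of_memLp_four h'.memLp_u).const_mul ε) h'.hj h'.flux
  have e : ∀ x, (u x - u' x) * (ε * (m x - 1) - ε * (m' x - 1))
      = (ε * u x - ε * u' x) * (m x - m' x) := fun x => by ring
  simp_rw [e] at key
  rw [sub_self] at key
  obtain ⟨i1, i2⟩ := integrable_monotonicity h.memLp_v h.memLp_m h'.memLp_v h'.memLp_m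
  have i : Integrable (fun x => (m x - m' x) ^ 2 + (m x + m' x) * (v x - v' x) ^ 2 / 2) :=
    i1.add i2
  rw [integral_eq_zero_iff_of_nonneg_ae ?_ i] at key
  · have hmv : ∀ᵐ x, m x = m' x ∧ v x = v' x := by
      filter_upwards [key, h.pos, h'.pos] with x h1 h2 h3
      simp only [Pi.zero_apply] at h1
      have hp : 0 ≤ (m x + m' x) * (v x - v' x) ^ 2 / 2 := by positivity
      have hq := sq_nonneg (m x - m' x)
      have e1 : (m x - m' x) ^ 2 = 0 := by linarith
      have e2 : (m x + m' x) * (v x - v' x) ^ 2 = 0 := by linarith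
      have e3 := (mul_eq_zero.1 e2).resolve_left (by positivity)
      exact ⟨sub_eq_zero.1 (pow_eq_zero_iff two_ne_zero |>.1 e1),
        sub_eq_zero.1 (pow_eq_zero_iff two_ne_zero |>.1 e3)⟩
    refine ⟨?_, hmv.mono fun x hx => hx.1⟩
    filter_upwards [hmv, h.hj, h'.hj] with x h1 h2 h3
    rw [h1.1, h1.2, h3] at h2
    have : ε * u' x = ε * u x := by linarith
    exact (mul_left_cancel₀ hε.ne' this).symm
  · filter_upwards [h.pos, h'.pos] with x h2 h3
    have : 0 ≤ (m x + m' x) * (v x - v' x) ^ 2 / 2 := by positivity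
    exact add_nonneg (sq_nonneg _) this

/-! ### Estimates uniform in the discount rate -/

lemma memLp_W : MemLp W 2 := memLp_of_continuous continuous_W 2

lemma DiscountData.integrable_m {ε : ℝ} {u v m : Torus → ℝ} (h : DiscountData ε u v m) :
    Integrable m := h.memLp_m.integrable (by norm_num)

/-- Testing the Hamilton–Jacobi equation with `m` and with 1, and the flux equation with `u`,
eliminates the terms in ε: `∫ m² + ½ ∫ m v² + ½ ∫ v² = 1 + ∫ m W - ∫ W ≤ 9`. -/
lemma DiscountData.integral_sq_le {ε : ℝ} {u v m : Torus → ℝ} (h : DiscountData ε u v m) :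
    ∫ x, v x ^ 2 ≤ 18 := by
  have hu2 := memLp_two_of_memLp_four h.memLp_u
  have hv2 := memLp_two_of_memLp_four h.memLp_v
  have Ium : Integrable (fun x => u x * m x) := integrable_mul_of_memLp_two hu2 h.memLp_m
  have Iu : Integrable u := h.weakDeriv.1
  have Iv : Integrable (fun x => v x ^ 2) := hv2.integrable_sq
  have Imv : Integrable (fun x => m x * v x ^ 2) := by
    simpa only [sq] using
      integrable_mul_of_memLp_two h.memLp_m (memLp_mul_of_memLp_four h.memLp_v h.memLp_v)
  have ImW : Integrable (fun x => m x * W x) := integrable_mul_of_memLp_two h.memLp_m memLp_W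
  have IW : Integrable W := integrable_of_continuous continuous_W
  have e1 : ∫ x, (m x) ^ 2 = ε * (∫ x, u x * m x) + (∫ x, m x * v x ^ 2) / 2 + ∫ x, m x * W x := by
    have I : Integrable (fun x => ε * (u x * m x) + m x * v x ^ 2 / 2) :=
      (Ium.const_mul ε).add (Imv.div_const 2)
    rw [← integral_const_mul, ← integral_div, ← integral_add (Ium.const_mul ε) (Imv.div_const 2),
      ← integral_add I ImW]
    refine integral_congr_ae ?_
    filter_upwards [h.hj] with x hx
    calc m x ^ 2 = m x * m x := sq _
      _ = m x * (ε * u x + v x ^ 2 / 2 + W x) := by rw [← hx]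
      _ = _ := by ring
  have e2 : ∫ x, m x = ε * (∫ x, u x) + (∫ x, v x ^ 2) / 2 + ∫ x, W x := by
    have I : Integrable (fun x => ε * u x + v x ^ 2 / 2) := (Iu.const_mul ε).add (Iv.div_const 2)
    rw [← integral_const_mul, ← integral_div,
      ← integral_add (Iu.const_mul ε) (Iv.div_const 2),
      ← integral_add I IW]
    exact integral_congr_ae h.hj
  rw [h.integral_m] at e2
  have e3 : ε * (∫ x, u x * m x) - ε * (∫ x, u x) = - ∫ x, m x * v x ^ 2 := by
    have := h.weakDeriv.integral_mul h.flux
    have a1 : ∀ x, u x * (ε * (m x - 1)) = ε * (u x * m x) - ε * u x := fun x => by ring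
    have a2 : ∀ x, v x * (m x * v x) = m x * v x ^ 2 := fun x => by ring
    simp_rw [a1, a2] at this
    rwa [integral_sub (Ium.const_mul ε) (Iu.const_mul ε), integral_const_mul,
      integral_const_mul] at this
  have p1 : 0 ≤ ∫ x, (m x) ^ 2 := integral_nonneg fun x => sq_nonneg _
  have p2 : 0 ≤ ∫ x, m x * v x ^ 2 := by
    refine integral_nonneg_of_ae ?_
    filter_upwards [h.pos] with x hx
    exact mul_nonneg hx.le (sq_nonneg _)
  have p3 : ∫ x, m x * W x ≤ 4 := by
    have : ∫ x, m x * W x ≤ ∫ x, m x * 4 := by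
      refine integral_mono_ae ImW (h.integrable_m.mul_const 4) ?_
      filter_upwards [h.pos] with x hx
      exact mul_le_mul_of_nonneg_left (le_of_abs_le (abs_W_le x)) hx.le
    rw [integral_mul_const, h.integral_m] at this
    linarith
  have p4 := (abs_le.1 (abs_integral_le_const (Eventually.of_forall abs_W_le))).1
  linarith

/-- Here `∫ |v| ≤ 1/2 + 18/2`, and the oscillation bound doubles it. -/
lemma DiscountData.ae_abs_bracket_le {ε : ℝ} {u v m : Torus → ℝ} (h : DiscountData ε u v m) :
    ∀ᵐ x, |u x - ∫ y, u y| ≤ 20 := by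
  have h1 := integral_abs_le_of_sq (memLp_two_of_memLp_four h.memLp_v) one_pos
  have h2 := h.integral_sq_le
  filter_upwards [h.weakDeriv.ae_abs_sub_integral_le] with x hx
  linarith

lemma DiscountData.abs_criterion_le {ε : ℝ} {u v m : Torus → ℝ} (h : DiscountData ε u v m) :
    |criterion u| ≤ 80 := by
  refine abs_integral_le_const ?_
  filter_upwards [h.ae_abs_bracket_le] with x hx
  rw [abs_mul, abs_of_nonneg (mErg_nonneg x)]
  have := mul_le_mul hx (mErg_le x) (mErg_nonneg x) (by norm_num)
  exact this.trans (by norm_num)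

lemma ae_abs_uTilde_le : ∀ᵐ x, |uTilde x| ≤ 12 := by
  have h1 := isWeakDeriv_uTilde.ae_abs_sub_integral_le
  have h2 : ∫ x, |slope (1 / 4) x| ≤ 6 := by
    refine (le_abs_self _).trans (abs_integral_le_const (Eventually.of_forall fun x => ?_))
    rw [abs_abs]; exact abs_slope_le _ x
  filter_upwards [h1] with x hx
  rw [integral_uTilde, sub_zero] at hx
  linarith

lemma integrable_uTilde_mul {f : Torus → ℝ} (hf : Integrable f) :
    Integrable (fun x => uTilde x * f x) := by
  have hm : AEStronglyMeasurable uTilde volume := isWeakDeriv_uTilde.1.aestronglyMeasurable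
  exact hf.bdd_mul hm ae_abs_uTilde_le

/-- The comparison of a discounted solution with the ergodic solution `(ũ, m, 0)`. -/
lemma DiscountData.comparison {ε : ℝ} {u v m : Torus → ℝ} (h : DiscountData ε u v m) :
    ∫ x, ((m x - mErg x) ^ 2 + (m x + mErg x) * (v x - slope (1 / 4) x) ^ 2 / 2)
      = ε * (- criterion u + ∫ x, uTilde x * (m x - 1)) := by
  have hflux : IsWeakDeriv (fun x => mErg x * slope (1 / 4) x) (fun _ => 0) := by
    simp only [mErg_mul_slope]
    exact ⟨integrable_zero _ _ _, integrable_zero _ _ _, by simp⟩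
  have hj : ∀ᵐ x, mErg x = (fun _ => (0:ℝ)) x + slope (1 / 4) x ^ 2 / 2 + W x := by
    filter_upwards [ae_slope_sq quarter_mem] with x hx
    rw [hx]; ring
  rw [monotonicity_identity h.weakDeriv h.memLp_v h.memLp_m
    ((memLp_two_of_memLp_four h.memLp_u).const_mul ε) h.hj h.flux isWeakDeriv_uTilde
    (memLp_slope _ 4) (memLp_of_continuous continuous_mErg 2) MemLp.zero' hj hflux]
  have hE : MemLp mErg 2 := memLp_of_continuous continuous_mErg 2
  have hu2 := memLp_two_of_memLp_four h.memLp_u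
  have hm1 : MemLp (fun x => m x - 1) 2 := h.memLp_m.sub (memLp_const 1)
  have hE1 : MemLp (fun x => mErg x - 1) 2 := hE.sub (memLp_const 1)
  have i1 : Integrable (fun x => (ε * u x - 0) * (m x - mErg x)) :=
    (integrable_mul_of_memLp_two (hu2.const_mul ε) (h.memLp_m.sub hE)).congr
      (Eventually.of_forall fun x => by simp)
  have i3 : Integrable (fun x => uTilde x * (m x - 1)) :=
    integrable_uTilde_mul (h.integrable_m.sub (integrable_const 1))
  have i2 : Integrable (fun x => (u x - uTilde x) * (ε * (m x - 1) - 0)) := by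
    refine (((integrable_mul_of_memLp_two hu2 hm1).sub i3).const_mul ε).congr
      (Eventually.of_forall fun x => ?_)
    simp only [Pi.sub_apply]; ring
  have i4 : Integrable (fun x => bracket u x * mErg x) :=
    integrable_mul_of_memLp_two (hu2.sub (memLp_const _)) hE
  have i5 : Integrable (fun x => u x - ∫ y, u y) := h.weakDeriv.1.sub (integrable_const _)
  have i6 : Integrable (fun x => mErg x - 1) := hE1.integrable (by norm_num)
  rw [← integral_sub i1 i2]
  -- The products `u m` cancel, leaving `ũ (m - 1)` and `u (1 - mErg)`; the latter is minus the
  -- criterion integrand up to terms of mean zero.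
  have e : ∀ x, (ε * u x - 0) * (m x - mErg x) - (u x - uTilde x) * (ε * (m x - 1) - 0)
      = ε * (uTilde x * (m x - 1)) - ε * (bracket u x * mErg x) + ε * (u x - ∫ y, u y)
        - (ε * ∫ y, u y) * (mErg x - 1) := fun x => by simp only [bracket]; ring
  simp_rw [e]
  have j1 : Integrable (fun x => ε * (uTilde x * (m x - 1)) - ε * (bracket u x * mErg x)) :=
    (i3.const_mul ε).sub (i4.const_mul ε)
  have j2 : Integrable (fun x => ε * (uTilde x * (m x - 1)) - ε * (bracket u x * mErg x)
      + ε * (u x - ∫ y, u y)) := j1.add (i5.const_mul ε)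
  rw [integral_sub j2 (i6.const_mul _), integral_add j1 (i5.const_mul ε),
    integral_sub (i3.const_mul ε) (i4.const_mul ε), integral_const_mul, integral_const_mul,
    integral_const_mul, integral_const_mul, integral_mErg_sub_one,
    integral_sub h.weakDeriv.1 (integrable_const _)]
  simp only [integral_const, probReal_univ, smul_eq_mul, one_mul, sub_self, mul_zero]
  rw [criterion]; ring

/-- 104 = 80 + 24: the first bounds the criterion, the second is `12 ∫ (m + 1)`. -/
lemma DiscountData.comparison_le {ε : ℝ} (hε : 0 < ε) {u v m : Torus → ℝ}
    (h : DiscountData ε u v m) :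
    ∫ x, ((m x - mErg x) ^ 2 + (m x + mErg x) * (v x - slope (1 / 4) x) ^ 2 / 2) ≤ 104 * ε := by
  rw [h.comparison]
  have h2 : ∫ x, uTilde x * (m x - 1) ≤ 24 := by
    have i3 : Integrable (fun x => uTilde x * (m x - 1)) :=
      integrable_uTilde_mul (h.integrable_m.sub (integrable_const 1))
    have i4 : Integrable (fun x => 12 * (m x + 1)) :=
      (h.integrable_m.add (integrable_const 1)).const_mul 12
    have : ∫ x, uTilde x * (m x - 1) ≤ ∫ x, 12 * (m x + 1) := by
      refine integral_mono_ae i3 i4 ?_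
      filter_upwards [h.pos, ae_abs_uTilde_le] with x hx1 hx2
      have h3 : |m x - 1| ≤ m x + 1 := by rw [abs_le]; constructor <;> linarith
      calc uTilde x * (m x - 1) ≤ |uTilde x| * |m x - 1| := by
            rw [← abs_mul]; exact le_abs_self _
        _ ≤ 12 * (m x + 1) := mul_le_mul hx2 h3 (abs_nonneg _) (by norm_num)
    rw [integral_const_mul, integral_add h.integrable_m (integrable_const 1), h.integral_m] at this
    simp at this
    linarith
  have h3 := (abs_le.1 h.abs_criterion_le).1
  nlinarith

lemma DiscountData.integral_sq_sub_mErg_le {ε : ℝ} (hε : 0 < ε) {u v m : Torus → ℝ}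
    (h : DiscountData ε u v m) :
    ∫ x, (m x - mErg x) ^ 2 ≤ 104 * ε ∧ ∫ x, mErg x * v x ^ 2 ≤ 208 * ε := by
  have hc := h.comparison_le hε
  obtain ⟨i1, i2⟩ := integrable_monotonicity h.memLp_v h.memLp_m (memLp_slope (1 / 4) 4)
    (memLp_of_continuous continuous_mErg 2)
  rw [integral_add i1 i2] at hc
  have p1 : 0 ≤ ∫ x, (m x - mErg x) ^ 2 := integral_nonneg fun x => sq_nonneg _
  have p2 : 0 ≤ ∫ x, (m x + mErg x) * (v x - slope (1 / 4) x) ^ 2 / 2 := by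
    refine integral_nonneg_of_ae ?_
    filter_upwards [h.pos] with x hx
    have := mErg_nonneg x
    simp only [Pi.zero_apply]
    positivity
  have p3 : ∫ x, mErg x * v x ^ 2
      ≤ ∫ x, 2 * ((m x + mErg x) * (v x - slope (1 / 4) x) ^ 2 / 2) := by
    refine integral_mono_ae ?_ (i2.const_mul 2) ?_
    · simpa only [sq] using integrable_mul_of_memLp_two (memLp_of_continuous continuous_mErg 2)
        (memLp_mul_of_memLp_four h.memLp_v h.memLp_v)
    · filter_upwards [h.pos] with x hx
      -- The slope of `ũ` is invisible to `mErg`.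
      have e : mErg x * v x ^ 2 = mErg x * (v x - slope (1 / 4) x) ^ 2 := by
        linear_combination (2 * v x - slope (1 / 4) x) * mErg_mul_slope (1 / 4) x
      have : 0 ≤ m x * (v x - slope (1 / 4) x) ^ 2 := by positivity
      rw [e]; linarith
  rw [integral_const_mul] at p3
  constructor <;> linarith

/-- From here on ε is written as a power, so that all rates are polynomial. -/
lemma DiscountData.integral_abs_sub_mErg_le {s : ℝ} (hs : 0 < s) {u v m : Torus → ℝ}
    (h : DiscountData (s ^ 2) u v m) : ∫ x, |m x - mErg x| ≤ 53 * s := by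
  have h1 := integral_abs_le_of_sq (f := fun x => m x - mErg x)
    (h.memLp_m.sub (memLp_of_continuous continuous_mErg 2)) hs
  have h2 := (h.integral_sq_sub_mErg_le (by positivity)).1
  have h3 : (∫ x, (m x - mErg x) ^ 2) / (2 * s) ≤ 52 * s := by
    rw [div_le_iff₀ (by positivity)]; linarith
  linarith

/-- The Hamilton–Jacobi equation is integrated against `mErg`, which has mass one and satisfies
`mErg W = mErg²`; this controls the mean of `s² u`, and the oscillation is at most `20 s²`. The
contributions are 212 + 104 + 80 + 20 ≤ 420. -/
lemma DiscountData.ae_abs_discount_le {s : ℝ} (hs : 0 < s) (hs1 : s ≤ 1) {u v m : Torus → ℝ}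
    (h : DiscountData (s ^ 2) u v m) : ∀ᵐ x, |s ^ 2 * u x| ≤ 420 * s := by
  have hE : MemLp mErg 2 := memLp_of_continuous continuous_mErg 2
  have hu2 := memLp_two_of_memLp_four h.memLp_u
  have hdm : Integrable (fun x => m x - mErg x) :=
    h.integrable_m.sub (integrable_of_continuous continuous_mErg)
  have i1 : Integrable (fun x => mErg x * (m x - mErg x)) :=
    integrable_mul_of_memLp_two hE (h.memLp_m.sub hE)
  have i2 : Integrable (fun x => mErg x * v x ^ 2) := by
    simpa only [sq] using integrable_mul_of_memLp_two hE
      (memLp_mul_of_memLp_four h.memLp_v h.memLp_v)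
  have i3 : Integrable (fun x => bracket u x * mErg x) :=
    integrable_mul_of_memLp_two (hu2.sub (memLp_const _)) hE
  have e : s ^ 2 * (∫ y, u y)
      = (∫ x, mErg x * (m x - mErg x)) - (∫ x, mErg x * v x ^ 2) / 2 - s ^ 2 * criterion u := by
    have e0 : s ^ 2 * (∫ y, u y) = ∫ x, (s ^ 2 * ∫ y, u y) * mErg x := by
      rw [integral_const_mul, integral_mErg, mul_one]
    have i4 : Integrable (fun x => mErg x * (m x - mErg x) - mErg x * v x ^ 2 / 2) :=
      i1.sub (i2.div_const 2)
    rw [e0, criterion, ← integral_const_mul (s ^ 2) (fun x => bracket u x * mErg x), ← integral_div, ← integral_sub i1 (i2.div_const 2),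
      ← integral_sub i4 (i3.const_mul _)]
    refine integral_congr_ae ?_
    filter_upwards [h.hj] with x hx
    simp only [bracket]
    linear_combination (-mErg x) * hx - mErg_mul_W x
  have b1 : |∫ x, mErg x * (m x - mErg x)| ≤ 4 * (53 * s) := by
    refine (abs_integral_le_integral_abs).trans ?_
    have : ∫ x, |mErg x * (m x - mErg x)| ≤ ∫ x, 4 * |m x - mErg x| := by
      refine integral_mono i1.abs (hdm.abs.const_mul 4) fun x => ?_
      simp only [abs_mul, abs_of_nonneg (mErg_nonneg x)]
      exact mul_le_mul_of_nonneg_right (mErg_le x) (abs_nonneg _)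
    rw [integral_const_mul] at this
    linarith [h.integral_abs_sub_mErg_le hs]
  have b2 := (h.integral_sq_sub_mErg_le (by positivity)).2
  have b2' : 0 ≤ ∫ x, mErg x * v x ^ 2 :=
    integral_nonneg fun x => mul_nonneg (mErg_nonneg x) (sq_nonneg _)
  have b3 := h.abs_criterion_le
  have hss : s ^ 2 ≤ s := by nlinarith
  have hs0 : 0 ≤ s ^ 2 := sq_nonneg s
  have b4 : |s ^ 2 * criterion u| ≤ 80 * s ^ 2 := by
    rw [abs_mul, abs_of_nonneg hs0]; nlinarith
  filter_upwards [h.ae_abs_bracket_le] with x hx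
  have b5 : |s ^ 2 * (u x - ∫ y, u y)| ≤ 20 * s ^ 2 := by
    rw [abs_mul, abs_of_nonneg hs0]; nlinarith
  have e5 : s ^ 2 * u x = s ^ 2 * (u x - ∫ y, u y) + s ^ 2 * ∫ y, u y := by ring
  rw [e5, e, abs_le]
  rw [abs_le] at b1 b4 b5
  constructor <;> linarith [b1.1, b1.2, b4.1, b4.2, b5.1, b5.2]

/-! ### The vanishing discount limit -/

/-- Only the sign of the comparison identity is used: dividing by `s²` gives `criterion u ≤ ∫ ũ (m -
1)`, and replacing `m` by `mErg` costs `12 · 53 s`. -/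
lemma DiscountData.criterion_sub_le {s : ℝ} (hs : 0 < s) {u v m : Torus → ℝ}
    (h : DiscountData (s ^ 2) u v m) : criterion u - criterion uTilde ≤ 636 * s := by
  have h0 : 0 ≤ s ^ 2 * (- criterion u + ∫ x, uTilde x * (m x - 1)) := by
    rw [← h.comparison]
    refine integral_nonneg_of_ae ?_
    filter_upwards [h.pos] with x hx
    have := mErg_nonneg x
    simp only [Pi.zero_apply]
    positivity
  have h1 := nonneg_of_mul_nonneg_right h0 (by positivity)
  have hE : Integrable mErg := integrable_of_continuous continuous_mErg
  have hdm : Integrable (fun x => m x - mErg x) := h.integrable_m.sub hE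
  have i1 := integrable_uTilde_mul hdm
  have i2 := integrable_uTilde_mul hE
  have e : ∫ x, uTilde x * (m x - 1) = (∫ x, uTilde x * (m x - mErg x)) + criterion uTilde := by
    unfold criterion bracket
    rw [integral_uTilde]
    simp only [sub_zero]
    have i3 : Integrable (fun x => uTilde x * (m x - mErg x) + uTilde x * mErg x) := i1.add i2
    have : ∀ x, uTilde x * (m x - 1)
        = uTilde x * (m x - mErg x) + uTilde x * mErg x - uTilde x := fun x => by ring
    simp_rw [this]
    rw [integral_sub i3 isWeakDeriv_uTilde.1, integral_add i1 i2, integral_uTilde, sub_zero]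
  have h2 : ∫ x, uTilde x * (m x - mErg x) ≤ ∫ x, 12 * |m x - mErg x| := by
    refine integral_mono_ae i1 (hdm.abs.const_mul 12) ?_
    filter_upwards [ae_abs_uTilde_le] with x hx
    calc uTilde x * (m x - mErg x) ≤ |uTilde x| * |m x - mErg x| := by
          rw [← abs_mul]; exact le_abs_self _
      _ ≤ 12 * |m x - mErg x| := mul_le_mul_of_nonneg_right hx (abs_nonneg _)
  rw [integral_const_mul] at h2
  linarith [h.integral_abs_sub_mErg_le hs]

/-- Subtracting the two Hamilton–Jacobi equations expresses the difference of squares by `m - mErg`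
and `s² u`, both of order `s`. -/
lemma DiscountData.integral_abs_sq_sub_le {s : ℝ} (hs : 0 < s) (hs1 : s ≤ 1)
    {u v m : Torus → ℝ} (h : DiscountData (s ^ 2) u v m) :
    ∫ x, |v x ^ 2 - slope (1 / 4) x ^ 2| ≤ 1000 * s := by
  have hdm : Integrable (fun x => m x - mErg x) :=
    h.integrable_m.sub (integrable_of_continuous continuous_mErg)
  have hi : Integrable (fun x => v x ^ 2 - slope (1 / 4) x ^ 2) :=
    (memLp_two_of_memLp_four h.memLp_v).integrable_sq.sub (memLp_slope _ 2).integrable_sq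
  have i2 : Integrable (fun x => 2 * |m x - mErg x| + 840 * s) :=
    (hdm.abs.const_mul 2).add (integrable_const _)
  have : ∫ x, |v x ^ 2 - slope (1 / 4) x ^ 2| ≤ ∫ x, (2 * |m x - mErg x| + 840 * s) := by
    refine integral_mono_ae hi.abs i2 ?_
    filter_upwards [h.hj, ae_slope_sq quarter_mem, h.ae_abs_discount_le hs hs1] with x h1 h2 h3
    have e : v x ^ 2 - slope (1 / 4) x ^ 2 = 2 * (m x - mErg x) - 2 * (s ^ 2 * u x) := by
      linarith
    rw [e]
    refine (abs_sub _ _).trans ?_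
    rw [abs_mul, abs_mul, abs_two]
    linarith
  rw [integral_add (hdm.abs.const_mul 2) (integrable_const _), integral_const_mul] at this
  simp only [integral_const, probReal_univ, smul_eq_mul, one_mul] at this
  linarith [h.integral_abs_sub_mErg_le hs]

/-- Since `(|v| - |q|)² ≤ |v² - q²|`, passing to the moduli costs a square root of the rate. -/
lemma DiscountData.integral_abs_abs_sub_le {r : ℝ} (hr : 0 < r) (hr1 : r ≤ 1)
    {u v m : Torus → ℝ} (h : DiscountData ((r ^ 2) ^ 2) u v m) :
    ∫ x, |(|v x| - |slope (1 / 4) x|)| ≤ 501 * r := by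
  have hm : MemLp (fun x => |v x| - |slope (1 / 4) x|) 2 :=
    (memLp_two_of_memLp_four h.memLp_v).abs.sub (memLp_slope _ 2).abs
  have h1 := integral_abs_le_of_sq hm hr
  have h2 := h.integral_abs_sq_sub_le (by positivity) (by nlinarith)
  have h3 : ∫ x, (|v x| - |slope (1 / 4) x|) ^ 2 ≤ ∫ x, |v x ^ 2 - slope (1 / 4) x ^ 2| := by
    refine integral_mono hm.integrable_sq ?_ fun x => ?_
    · exact ((memLp_two_of_memLp_four h.memLp_v).integrable_sq.sub
        (memLp_slope _ 2).integrable_sq).abs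
    · simp only
      rw [← sq_abs (v x), ← sq_abs (slope (1 / 4) x), sq_sub_sq, abs_mul, ← sq_abs, sq]
      refine mul_le_mul_of_nonneg_right ?_ (abs_nonneg _)
      refine ((abs_sub _ _).trans_eq ?_).trans (le_abs_self _)
      rw [abs_abs, abs_abs]
  have h4 : (∫ x, (|v x| - |slope (1 / 4) x|) ^ 2) / (2 * r) ≤ 500 * r := by
    rw [div_le_iff₀ (by positivity)]; nlinarith
  linarith

lemma abs_excess_le (x : Torus) : |excess x| ≤ 5 := by
  have hi : Integrable (fun x => mErg x - 1) :=
    integrable_of_continuous (continuous_mErg.sub continuous_const)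
  refine (abs_prim_le hi x).trans ?_
  refine (le_abs_self _).trans (abs_integral_le_const (Eventually.of_forall fun y => ?_))
  rw [abs_abs, abs_le]
  constructor <;> linarith [mErg_nonneg y, mErg_le y]

/-- The points whose representative is within `δ` of `1/4` or `3/4`. -/
def nearKinks (δ : ℝ) : Set Torus :=
  rep ⁻¹' (Ioo (1 / 4 - δ) (1 / 4 + δ) ∪ Ioo (3 / 4 - δ) (3 / 4 + δ))

lemma measurableSet_nearKinks (δ : ℝ) : MeasurableSet (nearKinks δ) :=
  measurable_rep (measurableSet_Ioo.union measurableSet_Ioo)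

lemma volume_nearKinks_le {δ : ℝ} (hδ : 0 ≤ δ) : volume.real (nearKinks δ) ≤ 4 * δ := by
  refine ENNReal.toReal_le_of_le_ofReal (by positivity) ?_
  rw [nearKinks, measurePreserving_rep.measure_preimage
    (measurableSet_Ioo.union measurableSet_Ioo).nullMeasurableSet]
  refine (Measure.restrict_apply_le _ _).trans ((measure_union_le _ _).trans ?_)
  rw [Real.volume_Ioo, Real.volume_Ioo, ← ENNReal.ofReal_add (by linarith) (by linarith)]
  exact ENNReal.ofReal_le_ofReal (by linarith)

lemma mem_nearKinks {δ : ℝ} {x : Torus} (hq : slope (1 / 4) x ≠ 0) (hG : |excess x| < δ) :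
    x ∈ nearKinks δ := by
  have hneg : potentialReal (rep x) < 0 := by
    by_contra hn
    exact hq (slopeTheta_eq_zero _ (not_lt.1 hn))
  rw [← coe_rep x] at hG
  rcases mem_of_potentialReal_neg hneg with hm | hm
  · rw [excess_coe_left (Ioo_subset_Icc_self hm), abs_lt] at hG
    exact Or.inl ⟨by linarith, by linarith⟩
  · rw [excess_coe_right (Ioo_subset_Icc_self hm), abs_lt] at hG
    exact Or.inr ⟨by linarith, by linarith⟩

/-- If `a` and `q` have the same sign, their distance is that of the moduli. If the signs are
opposite and `|g| ≥ δ`, then `a g ≤ 0`, so the defect `|q| |g| - a g` is at least `δ |q|`; if `|g| <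
δ`, the term `n` pays. The summand `|g| ||a| - |q||` keeps the bracket nonnegative, as `|a|` may
exceed `|q|`. -/
lemma abs_sub_le_of_aligned {a q g δ n : ℝ} (hδ : 0 < δ) (hn : 0 ≤ n)
    (hqg : q * g = |q| * |g|) (h : q ≠ 0 → |g| < δ → 2 * |q| ≤ n) :
    |a - q| ≤ |(|a| - |q|)| + 2 / δ * (|q| * |g| - a * g + |g| * |(|a| - |q|)|) + n := by
  have hB : 0 ≤ |q| * |g| - a * g + |g| * |(|a| - |q|)| := by
    have h1 : a * g ≤ |a| * |g| := by rw [← abs_mul]; exact le_abs_self _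
    have h2 := mul_le_mul_of_nonneg_left (le_abs_self (|a| - |q|)) (abs_nonneg g)
    nlinarith
  have hB' : 0 ≤ 2 / δ * (|q| * |g| - a * g + |g| * |(|a| - |q|)|) := by positivity
  rcases le_or_gt 0 (a * q) with hs | hs
  · have : |a - q| ≤ |(|a| - |q|)| := by
      refine sq_le_sq.1 ?_
      have : |a| * |q| = a * q := by rw [← abs_mul, abs_of_nonneg hs]
      nlinarith [sq_abs a, sq_abs q]
    linarith
  · have hq : q ≠ 0 := fun h0 => by simp [h0] at hs
    have htri : |a - q| ≤ |(|a| - |q|)| + 2 * |q| := by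
      have h1 := abs_sub a q
      have h2 := le_abs_self (|a| - |q|)
      linarith
    rcases lt_or_ge |g| δ with hg | hg
    · linarith [h hq hg]
    · have hag : a * g ≤ 0 := by
        have hq2 : 0 < q ^ 2 := by positivity
        have : (a * g) * q ^ 2 = (a * q) * (q * g) := by ring
        have h3 : (a * q) * (q * g) ≤ 0 :=
          mul_nonpos_of_nonpos_of_nonneg hs.le (by rw [hqg]; positivity)
        by_contra hc
        push Not at hc
        have := mul_pos hc hq2
        linarith
      have h4 : |q| * δ ≤ |q| * |g| - a * g + |g| * |(|a| - |q|)| := by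
        have h5 := mul_le_mul_of_nonneg_left hg (abs_nonneg q)
        have h6 : 0 ≤ |g| * |(|a| - |q|)| := by positivity
        linarith
      have h7 : 2 * |q| ≤ 2 / δ * (|q| * |g| - a * g + |g| * |(|a| - |q|)|) := by
        calc 2 * |q| = 2 / δ * (|q| * δ) := by field_simp
          _ ≤ _ := mul_le_mul_of_nonneg_left h4 (by positivity)
      linarith

/-- The threshold is `δ = k`: the moduli contribute `k² / k`, the criterion gap `k⁴ / k`, and the
neighbourhoods of the kinks `12 · 4 k`, so the total is of order `k`. -/
lemma DiscountData.integral_abs_sub_slope_le {k : ℝ} (hk : 0 < k) (hk1 : k ≤ 1)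
    {u v m : Torus → ℝ} (h : DiscountData (((k ^ 2) ^ 2) ^ 2) u v m) :
    ∫ x, |v x - slope (1 / 4) x| ≤ 10000 * k := by
  have hk2 : 0 < k ^ 2 := by positivity
  have hk2' : k ^ 2 ≤ 1 := by nlinarith
  have b1 := h.integral_abs_abs_sub_le hk2 hk2'
  have b2 := h.criterion_sub_le (by positivity)
  rw [criterion_sub_eq h.weakDeriv] at b2
  have iv := h.weakDeriv.2.1
  have iq := integrable_slope (1 / 4)
  have i0 : Integrable (fun x => |(|v x| - |slope (1 / 4) x|)|) := (iv.abs.sub iq.abs).abs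
  have i1 : Integrable (fun x => |slope (1 / 4) x| * |excess x| - v x * excess x) := by
    simp_rw [← abs_slope_mul_abs_excess]
    exact (integrable_mul_excess iq).sub (integrable_mul_excess iv)
  have i3 : Integrable ((nearKinks k).indicator (fun _ => (12:ℝ))) :=
    (integrable_const _).indicator (measurableSet_nearKinks k)
  have key : ∀ x, |v x - slope (1 / 4) x| ≤ (1 + 10 / k) * |(|v x| - |slope (1 / 4) x|)|
      + 2 / k * (|slope (1 / 4) x| * |excess x| - v x * excess x)
      + (nearKinks k).indicator (fun _ => (12:ℝ)) x := by
    intro x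
    have := abs_sub_le_of_aligned (a := v x) (n := (nearKinks k).indicator (fun _ => (12:ℝ)) x) hk
      (indicator_nonneg (fun _ _ => by norm_num) x) (abs_slope_mul_abs_excess x) (fun hq hG => by
        rw [indicator_of_mem (mem_nearKinks hq hG)]
        linarith [abs_slope_le (1 / 4) x])
    refine this.trans ?_
    have h1 := mul_le_mul_of_nonneg_right (abs_excess_le x)
      (abs_nonneg (|v x| - |slope (1 / 4) x|))
    have h2 := mul_le_mul_of_nonneg_left h1 (show 0 ≤ 2 / k by positivity)
    have e : 2 / k * (5 * |(|v x| - |slope (1 / 4) x|)|)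
        = 10 / k * |(|v x| - |slope (1 / 4) x|)| := by ring
    rw [e] at h2
    linarith
  have j1 : Integrable (fun x => (1 + 10 / k) * |(|v x| - |slope (1 / 4) x|)|
      + 2 / k * (|slope (1 / 4) x| * |excess x| - v x * excess x)) :=
    (i0.const_mul _).add (i1.const_mul _)
  have := integral_mono (iv.sub iq).abs (j1.add i3) key
  simp only [Pi.add_apply, Pi.sub_apply] at this
  rw [integral_add j1 i3, integral_add (i0.const_mul _) (i1.const_mul _), integral_const_mul,
    integral_const_mul, integral_indicator_const _ (measurableSet_nearKinks k), smul_eq_mul] at this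
  have b3 := volume_nearKinks_le hk.le
  have c1 : (1 + 10 / k) * ∫ x, |(|v x| - |slope (1 / 4) x|)| ≤ (1 + 10 / k) * (501 * k ^ 2) :=
    mul_le_mul_of_nonneg_left b1 (by positivity)
  have c2 : 2 / k * (∫ x, (|slope (1 / 4) x| * |excess x| - v x * excess x))
      ≤ 2 / k * (636 * (k ^ 2) ^ 2) := mul_le_mul_of_nonneg_left b2 (by positivity)
  have e1 : (1 + 10 / k) * (501 * k ^ 2) = 501 * k ^ 2 + 5010 * k := by field_simp; ring
  have e2 : 2 / k * (636 * (k ^ 2) ^ 2) = 1272 * k ^ 3 := by field_simp; ring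
  have p2 : k ^ 2 ≤ k := by nlinarith
  have p3 : k ^ 3 ≤ k := by nlinarith
  linarith

lemma abs_bracket_sub_uTilde_le {v : Torus → ℝ} (hv : Integrable v) (c : ℝ) (x : Torus) :
    |bracket (fun y => c + prim v y) x - uTilde x| ≤ 2 * ∫ y, |v y - slope (1 / 4) y| := by
  have hq := integrable_slope (1 / 4)
  obtain ⟨d, hd⟩ : ∃ d, uTilde = fun x => d + prim (slope (1 / 4)) x := ⟨_, uTheta_eq _ _⟩
  have e0 : d + ∫ y, prim (slope (1 / 4)) y = 0 := by
    have := integral_uTilde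
    rw [hd, integral_add (integrable_const _) (integrable_prim hq)] at this
    simpa using this
  have e1 : bracket (fun y => c + prim v y) x = prim v x - ∫ y, prim v y := by
    unfold bracket
    rw [integral_add (integrable_const _) (integrable_prim hv)]
    simp
  have hdiff : (prim fun y => v y - slope (1 / 4) y) = fun y => prim v y - prim (slope (1 / 4)) y :=
    funext (prim_sub hv hq)
  have := abs_sub_integral_prim_le (hv.sub hq) x
  simp only [Pi.sub_def] at this
  rw [hdiff, integral_sub (integrable_prim hv) (integrable_prim hq)] at this
  convert this using 2
  rw [e1, hd]
  linarith

lemma exists_continuous_representative {u v : Torus → ℝ} (h : IsWeakDeriv u v) :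
    ∃ U : C(Torus, ℝ), u =ᵐ[volume] U ∧ ∃ c, ∀ x, U x = c + prim v x := by
  obtain ⟨c, hc⟩ := h.exists_eq_prim
  exact ⟨⟨fun x => c + prim v x,
    continuous_const.add (continuous_prim h.2.1 h.integral_eq_zero)⟩, hc, c, fun _ => rfl⟩

lemma tendstoUniformly_bracket {u m : ℝ → Torus → ℝ}
    (h : ∀ ε : ℝ, 0 < ε → DiscountSol ε (u ε) (m ε)) :
    ∃ U : ℝ → C(Torus, ℝ), (∀ ε : ℝ, 0 < ε → u ε =ᵐ[volume] U ε) ∧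
      TendstoUniformly (fun ε => bracket (U ε)) uTilde (𝓝[>] (0 : ℝ)) := by
  have hex : ∀ ε : ℝ, ∃ U : C(Torus, ℝ), 0 < ε → ∃ v c, DiscountData ε (u ε) v (m ε) ∧
      u ε =ᵐ[volume] U ∧ ∀ x, U x = c + prim v x := by
    intro ε
    by_cases hε : 0 < ε
    · obtain ⟨v, hv⟩ := (h ε hε).exists_data hε
      obtain ⟨U, hU, c, hc⟩ := exists_continuous_representative hv.weakDeriv
      exact ⟨U, fun _ => ⟨v, c, hv, hU, hc⟩⟩
    · exact ⟨0, fun h => absurd h hε⟩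
  choose U hU using hex
  refine ⟨U, fun ε hε => ?_, ?_⟩
  · obtain ⟨v, c, -, h2, -⟩ := hU ε hε
    exact h2
  · rw [Metric.tendstoUniformly_iff]
    intro η hη
    -- The eighth root of ε, with 20000 = 2 · 10000 from the oscillation bound.
    set φ : ℝ → ℝ := fun ε => 20000 * Real.sqrt (Real.sqrt (Real.sqrt ε)) with hφ
    have hφc : Tendsto φ (𝓝[>] 0) (𝓝 0) := by
      have : Continuous φ := by fun_prop
      have h0 := this.tendsto 0
      simp only [hφ, Real.sqrt_zero, mul_zero] at h0
      exact h0.mono_left nhdsWithin_le_nhds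
    filter_upwards [hφc.eventually_lt_const hη, self_mem_nhdsWithin,
      mem_nhdsWithin_of_mem_nhds (Iio_mem_nhds one_pos)] with ε h1 h2 h3 x
    have hε : 0 < ε := h2
    obtain ⟨v, c, hd, -, hc⟩ := hU ε hε
    set k := Real.sqrt (Real.sqrt (Real.sqrt ε)) with hk
    have hk0 : 0 < k := by positivity
    have hk1 : k ≤ 1 := by
      have h4 : ε ≤ 1 := le_of_lt h3
      simp only [hk, Real.sqrt_le_one, h4]
    have hke : ((k ^ 2) ^ 2) ^ 2 = ε := by
      rw [hk, Real.sq_sqrt (by positivity), Real.sq_sqrt (by positivity), Real.sq_sqrt hε.le]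
    rw [← hke] at hd
    have b := hd.integral_abs_sub_slope_le hk0 hk1
    have b2 := abs_bracket_sub_uTilde_le hd.weakDeriv.2.1 c x
    have e : (⇑(U ε)) = fun y => c + prim v y := funext hc
    rw [Real.dist_eq, abs_sub_comm, e]
    have : φ ε = 20000 * k := rfl
    linarith

/-! ### The discount problem: existence by the direct method -/

/-- In a decreasing sequence of bounded sets that are closed under midpoints one can choose
points forming a Cauchy sequence: take points of almost minimal norm. -/
lemma exists_cauchySeq_of_antitone {H : Type*} [NormedAddCommGroup H] [InnerProductSpace ℝ H]
    {S : ℕ → Set H} (hanti : Antitone S) (hne : ∀ n, (S n).Nonempty)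
    (hmid : ∀ n, ∀ x ∈ S n, ∀ y ∈ S n, (1 / 2 : ℝ) • (x + y) ∈ S n)
    {R : ℝ} (hR : ∀ x ∈ S 0, ‖x‖ ^ 2 ≤ R) :
    ∃ p : ℕ → H, (∀ n, p n ∈ S n) ∧ CauchySeq p := by
  set d : ℕ → ℝ := fun n => sInf ((fun x => ‖x‖ ^ 2) '' S n) with hd
  have hbdd : ∀ n, BddBelow ((fun x : H => ‖x‖ ^ 2) '' S n) := fun n =>
    ⟨0, by rintro _ ⟨x, -, rfl⟩; positivity⟩
  have hdle : ∀ n, ∀ x ∈ S n, d n ≤ ‖x‖ ^ 2 := fun n x hx =>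
    csInf_le (hbdd n) ⟨x, hx, rfl⟩
  have hmono : Monotone d := fun n m hnm =>
    csInf_le_csInf (hbdd n) ((hne m).image _) (image_mono (hanti hnm))
  have hdR : ∀ n, d n ≤ R := fun n => by
    obtain ⟨x, hx⟩ := hne n
    exact (hdle n x hx).trans (hR x (hanti (Nat.zero_le n) hx))
  have hex : ∀ n : ℕ, ∃ x ∈ S n, ‖x‖ ^ 2 < d n + 1 / ((n : ℝ) + 1) := fun n => by
    obtain ⟨_, ⟨x, hx, rfl⟩, hlt⟩ := exists_lt_of_csInf_lt ((hne n).image (fun x => ‖x‖ ^ 2))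
      (show sInf ((fun x : H => ‖x‖ ^ 2) '' S n) < d n + 1 / ((n : ℝ) + 1) from
        lt_add_of_pos_right _ (by positivity))
    exact ⟨x, hx, hlt⟩
  choose p hpS hplt using hex
  have hlim := tendsto_atTop_ciSup hmono ⟨R, by rintro _ ⟨n, rfl⟩; exact hdR n⟩
  set L := ⨆ n, d n with hL
  have hdL : ∀ n, d n ≤ L := fun n => hmono.ge_of_tendsto hlim n
  -- The parallelogram law, with the midpoint of norm squared at least `d n`, bounds `‖p n - p m‖²`
  -- by `2 (d m - d n)` plus the two errors, each doubled.
  set b : ℕ → ℝ := fun n => 2 * (L - d n) + 4 * (1 / ((n : ℝ) + 1)) with hb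
  have hb0 : Tendsto (fun n => Real.sqrt (b n)) atTop (𝓝 0) := by
    have h1 : Tendsto b atTop (𝓝 (2 * (L - L) + 4 * 0)) :=
      ((tendsto_const_nhds.sub hlim).const_mul 2).add
        (tendsto_one_div_add_atTop_nhds_zero_nat.const_mul 4)
    have h2 := h1.sqrt
    simpa using h2
  have hle : ∀ n m, n ≤ m → ‖p n - p m‖ ^ 2 ≤ b n := fun n m hnm => by
    have h1 := hdle n _ (hmid n _ (hpS n) _ (hanti hnm (hpS m)))
    rw [norm_smul, mul_pow] at h1
    norm_num at h1
    have h2 := parallelogram_law_with_norm ℝ (p n) (p m)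
    have h3 : (1 : ℝ) / ((m : ℝ) + 1) ≤ 1 / ((n : ℝ) + 1) := by
      have : (n : ℝ) ≤ m := by exact_mod_cast hnm
      gcongr
    have h4 := hplt n
    have h5 := hplt m
    have h6 := hdL m
    simp only [hb]
    nlinarith
  refine ⟨p, hpS, cauchySeq_of_le_tendsto_0 (fun n => Real.sqrt (b n)) (fun n m N hn hm => ?_) hb0⟩
  have hbN : ∀ k, N ≤ k → b k ≤ b N := fun k hk => by
    have h1 := hmono hk
    have h2 : (1 : ℝ) / ((k : ℝ) + 1) ≤ 1 / ((N : ℝ) + 1) := by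
      have : (N : ℝ) ≤ k := by exact_mod_cast hk
      gcongr
    simp only [hb]
    linarith
  refine Real.le_sqrt_of_sq_le ?_
  rcases le_total n m with h | h
  · rw [dist_eq_norm]
    exact (hle n m h).trans (hbN n hn)
  · rw [dist_comm, dist_eq_norm]
    exact (hle m n h).trans (hbN m hm)

/-- Fatou's lemma for nonnegative integrable functions with bounded integrals. -/
lemma integrable_and_integral_le_of_tendsto_ae {α : Type*} [MeasurableSpace α] {μ : Measure α}
    {f : ℕ → α → ℝ} {F : α → ℝ} {r : ℕ → ℝ} {R : ℝ}
    (hf : ∀ n, Integrable (f n) μ) (hpos : ∀ n x, 0 ≤ f n x)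
    (hF : ∀ᵐ x ∂μ, Tendsto (fun n => f n x) atTop (𝓝 (F x)))
    (hr : ∀ n, ∫ x, f n x ∂μ ≤ r n) (hrR : Tendsto r atTop (𝓝 R)) :
    Integrable F μ ∧ ∫ x, F x ∂μ ≤ R := by
  have hFm : AEStronglyMeasurable F μ :=
    aestronglyMeasurable_of_tendsto_ae atTop (fun n => (hf n).aestronglyMeasurable) hF
  have hF0 : 0 ≤ᵐ[μ] F := by
    filter_upwards [hF] with x hx
    exact ge_of_tendsto' hx fun n => hpos n x
  have hR0 : 0 ≤ R := ge_of_tendsto' hrR fun n => (integral_nonneg (hpos n)).trans (hr n)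
  have hlint : ∫⁻ x, ENNReal.ofReal (F x) ∂μ ≤ ENNReal.ofReal R := by
    calc ∫⁻ x, ENNReal.ofReal (F x) ∂μ
        = ∫⁻ x, liminf (fun n => ENNReal.ofReal (f n x)) atTop ∂μ := by
          refine lintegral_congr_ae ?_
          filter_upwards [hF] with x hx
          exact ((ENNReal.continuous_ofReal.tendsto _).comp hx).liminf_eq.symm
      _ ≤ liminf (fun n => ∫⁻ x, ENNReal.ofReal (f n x) ∂μ) atTop :=
          lintegral_liminf_le' fun n => (hf n).aestronglyMeasurable.aemeasurable.ennreal_ofReal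
      _ ≤ liminf (fun n => ENNReal.ofReal (r n)) atTop := by
          refine liminf_le_liminf (Eventually.of_forall fun n => ?_)
          rw [← ofReal_integral_eq_lintegral_ofReal (hf n) (Eventually.of_forall (hpos n))]
          exact ENNReal.ofReal_le_ofReal (hr n)
      _ = ENNReal.ofReal R := ((ENNReal.continuous_ofReal.tendsto _).comp hrR).liminf_eq
  have hint : Integrable F μ :=
    (lintegral_ofReal_ne_top_iff_integrable hFm hF0).1 (hlint.trans_lt ENNReal.ofReal_lt_top).ne
  refine ⟨hint, ?_⟩
  rw [integral_eq_lintegral_of_nonneg_ae hF0 hFm]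
  exact ENNReal.toReal_le_of_le_ofReal hR0 hlint

/-- The function with mean-type constant `∫ g` and derivative `⟨g⟩`; every `W^{1,2}` function
arises in this way from exactly one `g ∈ L²`. -/
def value (g : Torus → ℝ) (x : Torus) : ℝ := (∫ y, g y) + prim (bracket g) x

/-- The left-hand side of the discounted Hamilton--Jacobi equation at `value g`. -/
def hjLhs (ε : ℝ) (g : Torus → ℝ) (x : Torus) : ℝ :=
  ε * value g x + bracket g x ^ 2 / 2 + W x

/-- The functional whose minimiser solves the discount problem. -/
def cost (ε : ℝ) (g : Torus → ℝ) : ℝ :=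
  (∫ x, max (hjLhs ε g x) 0 ^ 2) / 2 - ε * ∫ x, value g x

lemma bracket_memLp {g : Torus → ℝ} {p : ℝ≥0∞} (hg : MemLp g p) : MemLp (bracket g) p :=
  hg.sub (memLp_const _)

lemma integrable_bracket {g : Torus → ℝ} (hg : Integrable g) : Integrable (bracket g) :=
  hg.sub (integrable_const _)

lemma integral_bracket {g : Torus → ℝ} (hg : Integrable g) : ∫ x, bracket g x = 0 := by
  unfold bracket
  rw [integral_sub hg (integrable_const _)]
  simp

lemma continuous_value {g : Torus → ℝ} (hg : Integrable g) : Continuous (value g) :=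
  continuous_const.add (continuous_prim (integrable_bracket hg) (integral_bracket hg))

lemma isWeakDeriv_value {g : Torus → ℝ} (hg : Integrable g) : IsWeakDeriv (value g) (bracket g) :=
  isWeakDeriv_prim (integrable_bracket hg) (integral_bracket hg) _

lemma bracket_add_const_mul {f g : Torus → ℝ} (hf : Integrable f) (hg : Integrable g) (a b : ℝ)
    (x : Torus) : bracket (fun y => a * f y + b * g y) x = a * bracket f x + b * bracket g x := by
  unfold bracket
  rw [integral_add (hf.const_mul a) (hg.const_mul b), integral_const_mul, integral_const_mul]
  ring

lemma value_add_const_mul {f g : Torus → ℝ} (hf : Integrable f) (hg : Integrable g) (a b : ℝ)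
    (x : Torus) : value (fun y => a * f y + b * g y) x = a * value f x + b * value g x := by
  have h : bracket (fun y => a * f y + b * g y) = fun x => a * bracket f x + b * bracket g x :=
    funext (bracket_add_const_mul hf hg a b)
  unfold value
  rw [h, prim_add ((integrable_bracket hf).const_mul a) ((integrable_bracket hg).const_mul b),
    prim_const_mul, prim_const_mul, integral_add (hf.const_mul a) (hg.const_mul b),
    integral_const_mul, integral_const_mul]
  ring

lemma bracket_congr_ae {f g : Torus → ℝ} (h : f =ᵐ[volume] g) :
    bracket f =ᵐ[volume] bracket g := by
  filter_upwards [h] with x hx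
  rw [bracket, bracket, hx, integral_congr_ae h]

lemma value_congr_ae {f g : Torus → ℝ} (h : f =ᵐ[volume] g) : value f = value g := by
  funext x
  rw [value, value, integral_congr_ae h, prim_congr_ae (bracket_congr_ae h)]

lemma hjLhs_congr_ae {ε : ℝ} {f g : Torus → ℝ} (h : f =ᵐ[volume] g) :
    hjLhs ε f =ᵐ[volume] hjLhs ε g := by
  filter_upwards [bracket_congr_ae h] with x hx
  rw [hjLhs, hjLhs, hx, value_congr_ae h]

lemma posPart_sq_congr_ae {ε : ℝ} {f g : Torus → ℝ} (h : f =ᵐ[volume] g) :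
    (fun x => max (hjLhs ε f x) 0 ^ 2) =ᵐ[volume] fun x => max (hjLhs ε g x) 0 ^ 2 := by
  filter_upwards [hjLhs_congr_ae (ε := ε) h] with x hx
  rw [hx]

lemma cost_congr_ae {ε : ℝ} {f g : Torus → ℝ} (h : f =ᵐ[volume] g) : cost ε f = cost ε g := by
  rw [cost, cost, integral_congr_ae (posPart_sq_congr_ae h), value_congr_ae h]

lemma integrable_hjLhs (ε : ℝ) {g : Torus → ℝ} (hg : MemLp g 2) : Integrable (hjLhs ε g) :=
  (((integrable_of_continuous (continuous_value (hg.integrable (by norm_num)))).const_mul ε).add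
    ((bracket_memLp hg).integrable_sq.div_const 2)).add (integrable_of_continuous continuous_W)

lemma aestronglyMeasurable_posPart_sq (ε : ℝ) {g : Torus → ℝ} (hg : MemLp g 2) :
    AEStronglyMeasurable (fun x => max (hjLhs ε g x) 0 ^ 2) volume :=
  ((integrable_hjLhs ε hg).aestronglyMeasurable.sup aestronglyMeasurable_const).pow 2

lemma integral_hjLhs (ε : ℝ) {g : Torus → ℝ} (hg : MemLp g 2) :
    ∫ x, hjLhs ε g x = ε * (∫ x, value g x) + (∫ x, bracket g x ^ 2) / 2 + ∫ x, W x := by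
  have i1 : Integrable (fun x => ε * value g x) :=
    (integrable_of_continuous (continuous_value (hg.integrable (by norm_num)))).const_mul ε
  have i2 : Integrable (fun x => bracket g x ^ 2 / 2) :=
    (bracket_memLp hg).integrable_sq.div_const 2
  have i3 : Integrable (fun x => ε * value g x + bracket g x ^ 2 / 2) := i1.add i2
  unfold hjLhs
  rw [integral_add i3 (integrable_of_continuous continuous_W), integral_add i1 i2,
    integral_const_mul, integral_div]

/-- A family of lower bounds for the cost, from `y² / 2 ≥ b y - b² / 2`. -/
lemma le_cost {ε : ℝ} {g : Torus → ℝ} (hg : MemLp g 2)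
    (hi : Integrable (fun x => max (hjLhs ε g x) 0 ^ 2)) {b : ℝ} (hb : 0 ≤ b) :
    b * (ε * (∫ x, value g x) + (∫ x, bracket g x ^ 2) / 2 - 4) - b ^ 2 / 2
      - ε * (∫ x, value g x) ≤ cost ε g := by
  have h1 : ∫ x, (b * hjLhs ε g x - b ^ 2 / 2) ≤ ∫ x, max (hjLhs ε g x) 0 ^ 2 / 2 := by
    refine integral_mono (((integrable_hjLhs ε hg).const_mul b).sub (integrable_const _))
      (hi.div_const 2) fun x => ?_
    simp only
    have h := mul_le_mul_of_nonneg_left (le_max_left (hjLhs ε g x) 0) hb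
    nlinarith [sq_nonneg (max (hjLhs ε g x) 0 - b)]
  rw [integral_sub ((integrable_hjLhs ε hg).const_mul b) (integrable_const _), integral_const_mul,
    integral_hjLhs ε hg] at h1
  simp only [integral_const, probReal_univ, smul_eq_mul, one_mul] at h1
  have hW := (abs_le.1 (abs_integral_le_const (Eventually.of_forall abs_W_le))).1
  have hW' := mul_le_mul_of_nonneg_left hW hb
  have e := integral_div (μ := volume) (2 : ℝ) (fun x => max (hjLhs ε g x) 0 ^ 2)
  unfold cost
  rw [← e]
  linarith

/-- Coercivity, from three instances of `le_cost`: `b = 1` cancels the term in `∫ u` and bounds the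
slope, while `b = 0` and `b = 2` bound `ε ∫ u` from below and above. -/
lemma integral_sq_le_of_cost_le {ε : ℝ} (hε : 0 < ε) (K : ℝ) :
    ∃ R, ∀ g : Torus → ℝ, MemLp g 2 → Integrable (fun x => max (hjLhs ε g x) 0 ^ 2) →
      cost ε g ≤ K → ∫ x, g x ^ 2 ≤ R := by
  set V := 2 * (K + 5)
  set B := (|K| + 10) / ε + (1 / 2 + V / 2)
  refine ⟨2 * V + 2 * B ^ 2, fun g hg hi hK => ?_⟩
  have hv := bracket_memLp hg
  have hgi : Integrable g := hg.integrable (by norm_num)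
  have l0 := le_cost hg hi le_rfl
  have l1 := le_cost hg hi zero_le_one
  have l2 := le_cost hg hi zero_le_two
  have hvV : ∫ x, bracket g x ^ 2 ≤ V := by simp only [V]; linarith
  have hv0 : 0 ≤ ∫ x, bracket g x ^ 2 := integral_nonneg fun x => sq_nonneg _
  have hu : |ε * ∫ x, value g x| ≤ |K| + 10 := by
    rw [abs_le]
    constructor <;> linarith [le_abs_self K, abs_nonneg K]
  have hu' : |∫ x, value g x| ≤ (|K| + 10) / ε := by
    rw [le_div_iff₀ hε]
    rw [abs_mul, abs_of_pos hε] at hu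
    linarith
  have hp : |∫ x, prim (bracket g) x| ≤ 1 / 2 + V / 2 := by
    have h1 := abs_integral_le_const
      (Eventually.of_forall (abs_prim_le (integrable_bracket hgi)))
    have h2 := integral_abs_le_of_sq hv one_pos
    linarith
  have hc : |∫ x, g x| ≤ B := by
    have e : ∫ x, value g x = (∫ x, g x) + ∫ x, prim (bracket g) x := by
      unfold value
      rw [integral_add (integrable_const _) (integrable_prim (integrable_bracket hgi))]
      simp
    have e' : ∫ x, g x = (∫ x, value g x) - ∫ x, prim (bracket g) x := by linarith
    rw [e']
    exact (abs_sub _ _).trans (add_le_add hu' hp)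
  have hc2 : (∫ x, g x) ^ 2 ≤ B ^ 2 := sq_le_sq' (abs_le.1 hc).1 (abs_le.1 hc).2
  have h1 : ∫ x, g x ^ 2 ≤ ∫ x, (2 * bracket g x ^ 2 + 2 * (∫ y, g y) ^ 2) := by
    refine integral_mono hg.integrable_sq
      ((hv.integrable_sq.const_mul 2).add (integrable_const _)) fun x => ?_
    simp only [bracket]
    nlinarith [sq_nonneg (g x - (∫ y, g y) - ∫ y, g y)]
  rw [integral_add (hv.integrable_sq.const_mul 2) (integrable_const _), integral_const_mul] at h1
  simp only [integral_const, probReal_univ, smul_eq_mul, one_mul] at h1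
  linarith

lemma posPart_sq_midpoint_le {a b c : ℝ} (h : c ≤ (a + b) / 2) :
    max c 0 ^ 2 ≤ (max a 0 ^ 2 + max b 0 ^ 2) / 2 := by
  have h1 : max c 0 ≤ (max a 0 + max b 0) / 2 :=
    max_le (by linarith [le_max_left a 0, le_max_left b 0])
      (by linarith [le_max_right a 0, le_max_right b 0])
  have h2 := pow_le_pow_left₀ (le_max_right c 0) h1 2
  nlinarith [sq_nonneg (max a 0 - max b 0)]

/-- `hjLhs` is convex in `g`, being affine plus a square, and `y ↦ max y 0 ^ 2` is convex and
nondecreasing. -/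
lemma cost_midpoint_le (ε : ℝ) {f g : Torus → ℝ} (hf : MemLp f 2) (hg : MemLp g 2)
    (hfi : Integrable (fun x => max (hjLhs ε f x) 0 ^ 2))
    (hgi : Integrable (fun x => max (hjLhs ε g x) 0 ^ 2)) :
    Integrable (fun x => max (hjLhs ε (fun y => 1 / 2 * f y + 1 / 2 * g y) x) 0 ^ 2) ∧
      cost ε (fun y => 1 / 2 * f y + 1 / 2 * g y) ≤ (cost ε f + cost ε g) / 2 := by
  have if1 : Integrable f := hf.integrable (by norm_num)
  have ig1 : Integrable g := hg.integrable (by norm_num)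
  have hmid : MemLp (fun y => 1 / 2 * f y + 1 / 2 * g y) 2 :=
    (hf.const_mul _).add (hg.const_mul _)
  have hle : ∀ x, max (hjLhs ε (fun y => 1 / 2 * f y + 1 / 2 * g y) x) 0 ^ 2
      ≤ (max (hjLhs ε f x) 0 ^ 2 + max (hjLhs ε g x) 0 ^ 2) / 2 := fun x => by
    refine posPart_sq_midpoint_le ?_
    unfold hjLhs
    rw [value_add_const_mul if1 ig1, bracket_add_const_mul if1 ig1]
    nlinarith [sq_nonneg (bracket f x - bracket g x)]
  have i1 : Integrable (fun x => (max (hjLhs ε f x) 0 ^ 2 + max (hjLhs ε g x) 0 ^ 2) / 2) :=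
    (hfi.add hgi).div_const 2
  have i2 := i1.mono' (aestronglyMeasurable_posPart_sq ε hmid) (Eventually.of_forall fun x => by
    rw [Real.norm_of_nonneg (sq_nonneg _)]; exact hle x)
  refine ⟨i2, ?_⟩
  have h1 := integral_mono i2 i1 hle
  rw [integral_div, integral_add hfi hgi] at h1
  have e : ∫ x, value (fun y => 1 / 2 * f y + 1 / 2 * g y) x
      = 1 / 2 * (∫ x, value f x) + 1 / 2 * ∫ x, value g x := by
    simp_rw [value_add_const_mul if1 ig1]
    rw [integral_add ((integrable_of_continuous (continuous_value if1)).const_mul _)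
      ((integrable_of_continuous (continuous_value ig1)).const_mul _),
      integral_const_mul, integral_const_mul]
  unfold cost
  rw [e]
  linarith

lemma abs_value_sub_le {f g : Torus → ℝ} (hf : Integrable f) (hg : Integrable g) (x : Torus) :
    |value f x - value g x| ≤ 3 * ∫ y, |f y - g y| := by
  have e := value_add_const_mul hf hg 1 (-1) x
  have hfg : (fun y => 1 * f y + -1 * g y) = fun y => f y - g y := by funext y; ring
  have e' : value f x - value g x = value (fun y => f y - g y) x := by rw [← hfg, e]; ring
  have hi : Integrable (fun y => f y - g y) := hf.sub hg
  have h1 : |∫ y, (f y - g y)| ≤ ∫ y, |f y - g y| := abs_integral_le_integral_abs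
  have h2 := abs_prim_le (integrable_bracket hi) x
  have h3 : ∫ y, |bracket (fun y => f y - g y) y| ≤ ∫ y, (|f y - g y| + |∫ z, (f z - g z)|) :=
    integral_mono (integrable_bracket hi).abs (hi.abs.add (integrable_const _))
      fun y => abs_sub _ _
  rw [integral_add hi.abs (integrable_const _)] at h3
  simp only [integral_const, probReal_univ, smul_eq_mul, one_mul] at h3
  rw [e', value]
  refine (abs_add_le _ _).trans ?_
  linarith

lemma integral_abs_le_norm (f : Lp ℝ 2 (volume : Measure Torus)) : ∫ x, |f x| ≤ ‖f‖ := by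
  have h := eLpNorm_le_eLpNorm_of_exponent_le (μ := (volume : Measure Torus)) (p := 1) (q := 2)
    (by norm_num) (Lp.aestronglyMeasurable f)
  rw [Lp.norm_def]
  have e : ∫ x, |f x| = (eLpNorm f 1 volume).toReal := by
    rw [eLpNorm_one_eq_lintegral_enorm]
    exact integral_norm_eq_lintegral_enorm (Lp.aestronglyMeasurable f)
  rw [e]
  exact ENNReal.toReal_mono (Lp.eLpNorm_ne_top f) h

lemma integral_sq_eq_norm_sq (f : Lp ℝ 2 (volume : Measure Torus)) : ∫ x, f x ^ 2 = ‖f‖ ^ 2 := by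
  rw [← real_inner_self_eq_norm_sq, L2.inner_def]
  refine integral_congr_ae (Eventually.of_forall fun x => ?_)
  simp [sq]

lemma coeFn_midpoint (f g : Lp ℝ 2 (volume : Measure Torus)) :
    ⇑((1 / 2 : ℝ) • (f + g)) =ᵐ[volume] fun x => 1 / 2 * f x + 1 / 2 * g x := by
  filter_upwards [Lp.coeFn_smul (1 / 2 : ℝ) (f + g), Lp.coeFn_add f g] with x h1 h2
  rw [h1, Pi.smul_apply, h2, Pi.add_apply, smul_eq_mul]; ring

/-- The cost attains its minimum. -/
lemma exists_minimiser {ε : ℝ} (hε : 0 < ε) :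
    ∃ g : Torus → ℝ, MemLp g 2 ∧ Integrable (fun x => max (hjLhs ε g x) 0 ^ 2) ∧
      ∀ f : Torus → ℝ, MemLp f 2 → Integrable (fun x => max (hjLhs ε f x) 0 ^ 2) →
        cost ε g ≤ cost ε f := by
  -- The integral in `cost` is 0 for a non-integrable square, so finiteness has to be imposed
  -- separately.
  set D : Set (Lp ℝ 2 (volume : Measure Torus)) :=
    {g | Integrable (fun x => max (hjLhs ε g x) 0 ^ 2)} with hD
  have hbdd : BddBelow ((fun g : Lp ℝ 2 (volume : Measure Torus) => cost ε g) '' D) := by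
    refine ⟨-5, ?_⟩
    rintro _ ⟨g, hg, rfl⟩
    have := le_cost (Lp.memLp g) hg zero_le_one
    have h0 : 0 ≤ ∫ x, bracket g x ^ 2 := integral_nonneg fun x => sq_nonneg _
    simp only
    linarith
  have h0D : (0 : Lp ℝ 2 (volume : Measure Torus)) ∈ D := by
    have e0 : ⇑(0 : Lp ℝ 2 (volume : Measure Torus)) =ᵐ[volume] fun _ => (0:ℝ) :=
      Lp.coeFn_zero _ _ _
    refine Integrable.congr ?_ (posPart_sq_congr_ae e0).symm
    have : hjLhs ε (fun _ => (0:ℝ)) = W := by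
      funext x
      simp [hjLhs, value, bracket, prim]
    rw [this]
    exact integrable_of_continuous ((continuous_W.max continuous_const).pow 2)
  set I := sInf ((fun g : Lp ℝ 2 (volume : Measure Torus) => cost ε g) '' D) with hI
  set S : ℕ → Set (Lp ℝ 2 (volume : Measure Torus)) :=
    fun n => {g | g ∈ D ∧ cost ε g ≤ I + 1 / ((n : ℝ) + 1)} with hS
  have hanti : Antitone S := fun n m hnm g hg => by
    refine ⟨hg.1, hg.2.trans ?_⟩
    have : (n : ℝ) ≤ m := by exact_mod_cast hnm
    gcongr
  have hne : ∀ n, (S n).Nonempty := fun n => by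
    obtain ⟨_, ⟨g, hg, rfl⟩, hlt⟩ := exists_lt_of_csInf_lt (⟨_, mem_image_of_mem _ h0D⟩)
      (show I < I + 1 / ((n : ℝ) + 1) from lt_add_of_pos_right _ (by positivity))
    exact ⟨g, hg, hlt.le⟩
  have hmid : ∀ n, ∀ f ∈ S n, ∀ g ∈ S n, (1 / 2 : ℝ) • (f + g) ∈ S n := by
    intro n f hf g hg
    obtain ⟨h1, h2⟩ := cost_midpoint_le ε (Lp.memLp f) (Lp.memLp g) hf.1 hg.1
    have hc := coeFn_midpoint f g
    refine ⟨h1.congr (posPart_sq_congr_ae hc).symm, ?_⟩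
    rw [cost_congr_ae hc]
    linarith [hf.2, hg.2]
  obtain ⟨R, hR⟩ := integral_sq_le_of_cost_le hε (I + 1 / (((0 : ℕ) : ℝ) + 1))
  obtain ⟨p, hpS, hpc⟩ := exists_cauchySeq_of_antitone hanti hne hmid (R := R) (fun g hg => by
    rw [← integral_sq_eq_norm_sq]
    exact hR g (Lp.memLp g) hg.1 hg.2)
  obtain ⟨h, hh⟩ := cauchySeq_tendsto_of_complete hpc
  have hint : ∀ g : Lp ℝ 2 (volume : Measure Torus), Integrable g := fun g =>
    (Lp.memLp g).integrable (by norm_num)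
  have hL1 : Tendsto (fun n => ∫ x, |p n x - h x|) atTop (𝓝 0) := by
    refine squeeze_zero (fun n => integral_nonneg fun x => abs_nonneg _) (fun n => ?_)
      (tendsto_iff_norm_sub_tendsto_zero.1 hh)
    refine le_trans (le_of_eq ?_) (integral_abs_le_norm (p n - h))
    refine integral_congr_ae ?_
    filter_upwards [Lp.coeFn_sub (p n) h] with x hx
    rw [hx, Pi.sub_apply]
  have hmean : Tendsto (fun n => ∫ x, p n x) atTop (𝓝 (∫ x, h x)) := by
    rw [tendsto_iff_dist_tendsto_zero]
    refine squeeze_zero (fun n => dist_nonneg) (fun n => ?_) hL1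
    rw [Real.dist_eq, ← integral_sub (hint _) (hint _)]
    exact abs_integral_le_integral_abs
  have hval : ∀ x, Tendsto (fun n => value (p n) x) atTop (𝓝 (value h x)) := fun x => by
    rw [tendsto_iff_dist_tendsto_zero]
    refine squeeze_zero (fun n => dist_nonneg)
      (fun n => abs_value_sub_le (hint (p n)) (hint h) x) ?_
    simpa using hL1.const_mul 3
  have hvalint : Tendsto (fun n => ∫ x, value (p n) x) atTop (𝓝 (∫ x, value h x)) := by
    rw [tendsto_iff_dist_tendsto_zero]
    refine squeeze_zero (fun n => dist_nonneg) (g := fun n => 3 * ∫ x, |p n x - h x|)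
      (fun n => ?_) (by simpa using hL1.const_mul 3)
    rw [Real.dist_eq, ← integral_sub (integrable_of_continuous (continuous_value (hint _)))
      (integrable_of_continuous (continuous_value (hint _)))]
    exact abs_integral_le_const
      (Eventually.of_forall fun x => abs_value_sub_le (hint (p n)) (hint h) x)
  -- Values converge at every point already, but slopes converge a.e. only along a subsequence.
  obtain ⟨ns, hns, hae⟩ := (tendstoInMeasure_of_tendsto_Lp hh).exists_seq_tendsto_ae
  have hns' := hns.tendsto_atTop
  have hFat := integrable_and_integral_le_of_tendsto_ae
    (μ := (volume : Measure Torus))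
    (f := fun n x => max (hjLhs ε (p (ns n)) x) 0 ^ 2)
    (F := fun x => max (hjLhs ε h x) 0 ^ 2)
    (r := fun n => 2 * (I + 1 / ((ns n : ℝ) + 1) + ε * ∫ x, value (p (ns n)) x))
    (R := 2 * (I + 0 + ε * ∫ x, value h x))
    (fun n => (hpS (ns n)).1) (fun n x => sq_nonneg _) ?_ (fun n => ?_) ?_
  · refine ⟨h, Lp.memLp h, hFat.1, fun f hf hfi => ?_⟩
    have h1 : cost ε h ≤ I := by
      have := hFat.2
      unfold cost
      linarith
    have hc := hf.coeFn_toLp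
    refine h1.trans (csInf_le hbdd ⟨hf.toLp f, ?_, ?_⟩)
    · exact hfi.congr (posPart_sq_congr_ae hc).symm
    · exact cost_congr_ae hc
  · filter_upwards [hae] with x hx
    have hb : Tendsto (fun n => bracket (p (ns n)) x) atTop (𝓝 (bracket h x)) :=
      hx.sub (hmean.comp hns')
    have hj : Tendsto (fun n => hjLhs ε (p (ns n)) x) atTop (𝓝 (hjLhs ε h x)) :=
      ((((hval x).comp hns').const_mul ε).add ((hb.pow 2).div_const 2)).add tendsto_const_nhds
    exact (hj.max tendsto_const_nhds).pow 2
  · have := (hpS (ns n)).2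
    unfold cost at this
    linarith
  · exact ((tendsto_const_nhds.add (tendsto_one_div_add_atTop_nhds_zero_nat.comp hns')).add
      ((hvalint.comp hns').const_mul ε)).const_mul 2

/-- `y ↦ max y 0 ^ 2` has the 2-Lipschitz derivative `2 max y 0`, so its Taylor remainder is at most
`d²`. -/
lemma posPart_sq_le (a d : ℝ) :
    max (a + d) 0 ^ 2 ≤ max a 0 ^ 2 + 2 * (max a 0 * d) + d ^ 2 := by
  rcases le_total 0 (a + d) with h1 | h1 <;> rcases le_total 0 a with h2 | h2
  · rw [max_eq_left h1, max_eq_left h2]; nlinarith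
  · rw [max_eq_left h1, max_eq_right h2]; nlinarith
  · rw [max_eq_right h1, max_eq_left h2]; nlinarith [sq_nonneg (a + d)]
  · rw [max_eq_right h1, max_eq_right h2]; nlinarith [sq_nonneg d]

lemma eq_zero_of_forall_quadratic_nonneg {L Q : ℝ}
    (h : ∀ t : ℝ, |t| ≤ 1 → 0 ≤ t * L + t ^ 2 * Q) : L = 0 := by
  have hQ : 0 ≤ Q := by
    have h1 := h 1 (by simp)
    have h2 := h (-1) (by simp)
    linarith
  -- Small enough that `t (Q + 1) ≤ |L|`, against the inequality `|L| ≤ t Q` that nonnegativity at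
  -- `t` and `-t` would force.
  set t := min 1 (|L| / (Q + 1)) with ht
  have ht1 : t ≤ 1 := min_le_left _ _
  have ht0 : 0 ≤ t := le_min zero_le_one (by positivity)
  have htL : t * (Q + 1) ≤ |L| := by
    rw [← le_div_iff₀ (by positivity)]; exact min_le_right _ _
  have h1 := h t (by rw [abs_of_nonneg ht0]; exact ht1)
  have h2 := h (-t) (by rw [abs_neg, abs_of_nonneg ht0]; exact ht1)
  have h3 : t * |L| ≤ t ^ 2 * Q := by
    rcases abs_cases L with ⟨e, -⟩ | ⟨e, -⟩ <;> rw [e] <;> linarith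
  by_contra hL
  have hLpos : 0 < |L| := abs_pos.2 hL
  have htpos : 0 < t := lt_min one_pos (by positivity)
  have h4 : |L| ≤ t * Q := by
    refine le_of_mul_le_mul_left ?_ htpos
    linarith
  linarith

/-- The Euler--Lagrange equation of the cost. -/
lemma eulerLagrange {ε : ℝ} {g : Torus → ℝ} (hg : MemLp g 2)
    (hgi : Integrable (fun x => max (hjLhs ε g x) 0 ^ 2))
    (hmin : ∀ f : Torus → ℝ, MemLp f 2 → Integrable (fun x => max (hjLhs ε f x) 0 ^ 2) →
        cost ε g ≤ cost ε f)
    {ψ ψ' : C(Torus, ℝ)} (hψ : IsC1WithDeriv ψ ψ') :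
    ∫ x, max (hjLhs ε g x) 0 * (ε * ψ x + bracket g x * ψ' x) = ε * ∫ x, ψ x := by
  obtain ⟨hψ0, hψp⟩ := hψ.eq_prim
  have ig : Integrable g := hg.integrable (by norm_num)
  -- Chosen so that `value φ = ψ`: its bracket is `ψ'` and its mean is the initial value `ψ 0`.
  set φ : Torus → ℝ := fun x => ψ' x + ψ ((0:ℝ) : Torus) with hφ
  have hφc : Continuous φ := ψ'.continuous.add continuous_const
  have iφ : Integrable φ := integrable_of_continuous hφc
  have hφm : ∫ x, φ x = ψ ((0:ℝ) : Torus) := by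
    simp only [hφ]
    rw [integral_add (integrable_continuousMap ψ') (integrable_const _), hψ0]
    simp
  have hbφ : bracket φ = fun x => ψ' x := by
    funext x
    rw [bracket, hφm]; simp [hφ]
  have hvφ : value φ = fun x => ψ x := by
    funext x
    rw [value, hφm, hbφ, hψp x]
  set m : Torus → ℝ := fun x => max (hjLhs ε g x) 0 with hm
  set β : Torus → ℝ := fun x => ε * ψ x + bracket g x * ψ' x with hβ
  have hmm : MemLp m 2 :=
    (memLp_two_iff_integrable_sq
      ((integrable_hjLhs ε hg).aestronglyMeasurable.sup aestronglyMeasurable_const)).2 hgi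
  have hψ'b : MemLp (fun x => bracket g x * ψ' x) 2 :=
    (bracket_memLp hg).of_le_mul (c := ‖ψ'‖)
      ((bracket_memLp hg).aestronglyMeasurable.mul ψ'.continuous.aestronglyMeasurable)
      (Eventually.of_forall fun x => by
        rw [norm_mul, mul_comm]
        exact mul_le_mul_of_nonneg_right (ψ'.norm_coe_le_norm x) (norm_nonneg _))
  have hβm : MemLp β 2 := ((memLp_of_continuous ψ.continuous 2).const_mul ε).add hψ'b
  have hγ : MemLp (fun x => ψ' x ^ 2 / 2) 2 :=
    memLp_of_continuous ((ψ'.continuous.pow 2).div_const 2) 2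
  have hδ : MemLp (fun x => |β x| + ψ' x ^ 2 / 2) 2 := hβm.abs.add hγ
  have i1 : Integrable (fun x => m x * β x) := integrable_mul_of_memLp_two hmm hβm
  have i2 : Integrable (fun x => m x * (ψ' x ^ 2 / 2)) := integrable_mul_of_memLp_two hmm hγ
  have i3 : Integrable (fun x => (|β x| + ψ' x ^ 2 / 2) ^ 2) := hδ.integrable_sq
  have iv := integrable_of_continuous (continuous_value ig)
  have iψ := integrable_continuousMap ψ
  -- `L` is the first variation; `Q` bounds the second-order terms uniformly for `|t| ≤ 1`.
  refine sub_eq_zero.1 (eq_zero_of_forall_quadratic_nonneg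
    (L := (∫ x, m x * β x) - ε * ∫ x, ψ x)
    (Q := (∫ x, m x * (ψ' x ^ 2 / 2)) + (∫ x, (|β x| + ψ' x ^ 2 / 2) ^ 2) / 2) fun t ht => ?_)
  set f : Torus → ℝ := fun y => 1 * g y + t * φ y with hf
  have hfm : MemLp f 2 := (hg.const_mul 1).add ((memLp_of_continuous hφc 2).const_mul t)
  have hvf : ∀ x, value f x = value g x + t * ψ x := fun x => by
    rw [hf, value_add_const_mul ig iφ, hvφ]; ring
  have hjf : ∀ x, hjLhs ε f x = hjLhs ε g x + (t * β x + t ^ 2 * (ψ' x ^ 2 / 2)) := fun x => by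
    unfold hjLhs
    rw [hvf, hf, bracket_add_const_mul ig iφ, hbφ]
    simp only [hβ]; ring
  have hle : ∀ x, max (hjLhs ε f x) 0 ^ 2 ≤ m x ^ 2 + 2 * t * (m x * β x)
      + 2 * t ^ 2 * (m x * (ψ' x ^ 2 / 2)) + t ^ 2 * (|β x| + ψ' x ^ 2 / 2) ^ 2 := fun x => by
    rw [hjf]
    refine (posPart_sq_le _ _).trans ?_
    have hd : (t * β x + t ^ 2 * (ψ' x ^ 2 / 2)) ^ 2 ≤ t ^ 2 * (|β x| + ψ' x ^ 2 / 2) ^ 2 := by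
      rw [← mul_pow]
      refine sq_le_sq.2 ?_
      rw [abs_mul, abs_of_nonneg (a := |β x| + ψ' x ^ 2 / 2) (by positivity),
        mul_add |t| |β x|]
      refine (abs_add_le _ _).trans (add_le_add (abs_mul _ _).le ?_)
      rw [abs_of_nonneg (by positivity), ← sq_abs t, sq]
      refine mul_le_mul_of_nonneg_right ?_ (by positivity)
      exact mul_le_of_le_one_left (abs_nonneg _) ht
    simp only [hm]
    linarith
  have j1 : Integrable (fun x => m x ^ 2 + 2 * t * (m x * β x)) := hgi.add (i1.const_mul _)
  have j2 : Integrable (fun x => m x ^ 2 + 2 * t * (m x * β x)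
      + 2 * t ^ 2 * (m x * (ψ' x ^ 2 / 2))) := j1.add (i2.const_mul _)
  have j3 : Integrable (fun x => m x ^ 2 + 2 * t * (m x * β x)
      + 2 * t ^ 2 * (m x * (ψ' x ^ 2 / 2)) + t ^ 2 * (|β x| + ψ' x ^ 2 / 2) ^ 2) :=
    j2.add (i3.const_mul _)
  have hfi := j3.mono' (aestronglyMeasurable_posPart_sq ε hfm) (Eventually.of_forall fun x => by
    rw [Real.norm_of_nonneg (sq_nonneg _)]; exact hle x)
  have h1 := integral_mono hfi j3 hle
  rw [integral_add j2 (i3.const_mul _), integral_add j1 (i2.const_mul _),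
    integral_add hgi (i1.const_mul _), integral_const_mul, integral_const_mul,
    integral_const_mul] at h1
  have h2 := hmin f hfm hfi
  have e : ∫ x, value f x = (∫ x, value g x) + t * ∫ x, ψ x := by
    simp_rw [hvf]
    rw [integral_add iv (iψ.const_mul t), integral_const_mul]
  unfold cost at h2
  rw [e] at h2
  linarith

lemma memLp_four_of_sq {v : Torus → ℝ} (hm : AEStronglyMeasurable v volume)
    (h : MemLp (fun x => v x ^ 2) 2) : MemLp v 4 := by
  rw [← memLp_norm_rpow_iff (q := 2) (p := 4) hm (by norm_num) (by norm_num)]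
  have e : (4 : ℝ≥0∞) / 2 = 2 := by
    have h4 : (4 : ℝ≥0∞) = 2 * 2 := by norm_num
    rw [h4, ENNReal.mul_div_cancel_right (by norm_num) (by norm_num)]
  rw [e]
  simpa using h

/-- With `m` the positive part of `hjLhs` at the minimiser, the Hamilton–Jacobi relations hold by
construction, the Euler–Lagrange equation is the flux equation, and its instance `ψ = 1` gives mass
one. -/
lemma exists_discountSol {ε : ℝ} (hε : 0 < ε) : ∃ u m : Torus → ℝ, DiscountSol ε u m := by
  obtain ⟨g, hg, hgi, hmin⟩ := exists_minimiser hε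
  have ig : Integrable g := hg.integrable (by norm_num)
  have hb := bracket_memLp hg
  have hcv := continuous_value ig
  have hmm : MemLp (fun x => max (hjLhs ε g x) 0) 2 :=
    (memLp_two_iff_integrable_sq
      ((integrable_hjLhs ε hg).aestronglyMeasurable.sup aestronglyMeasurable_const)).2 hgi
  have him : Integrable (fun x => max (hjLhs ε g x) 0) := hmm.integrable (by norm_num)
  have himb : Integrable (fun x => max (hjLhs ε g x) 0 * bracket g x) :=
    integrable_mul_of_memLp_two hmm hb
  have hEL {ψ ψ' : C(Torus, ℝ)} (hψ : IsC1WithDeriv ψ ψ') :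
      ε * (∫ x, max (hjLhs ε g x) 0 * ψ x)
        + ∫ x, max (hjLhs ε g x) 0 * bracket g x * ψ' x = ε * ∫ x, ψ x := by
    have i1 : Integrable (fun x => max (hjLhs ε g x) 0 * ψ x) :=
      integrable_mul_of_bounded him ψ.continuous.aestronglyMeasurable
        (fun x => ψ.norm_coe_le_norm x)
    have i2 : Integrable (fun x => max (hjLhs ε g x) 0 * bracket g x * ψ' x) :=
      integrable_mul_of_bounded himb ψ'.continuous.aestronglyMeasurable
        (fun x => ψ'.norm_coe_le_norm x)
    rw [← eulerLagrange hg hgi hmin hψ, ← integral_const_mul, ← integral_add (i1.const_mul ε) i2]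
    refine integral_congr_ae (Eventually.of_forall fun x => ?_)
    simp only; ring
  -- Finite cost improves integrability: `v² ≤ 2 m + 2 (|ε u| + 4)`, which lies in L².
  have hb4 : MemLp (bracket g) 4 := by
    refine memLp_four_of_sq hb.aestronglyMeasurable ?_
    have hdom : MemLp (fun x => 2 * max (hjLhs ε g x) 0 + 2 * (|ε * value g x| + 4)) 2 :=
      (hmm.const_mul 2).add
        (memLp_of_continuous ((((hcv.const_mul ε).abs).add continuous_const).const_mul 2) 2)
    refine hdom.mono (hb.aestronglyMeasurable.pow 2) (Eventually.of_forall fun x => ?_)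
    rw [Real.norm_of_nonneg (sq_nonneg _)]
    refine le_trans ?_ (le_abs_self _)
    have h1 : hjLhs ε g x = ε * value g x + bracket g x ^ 2 / 2 + W x := rfl
    have h2 := le_max_left (hjLhs ε g x) 0
    have h3 := neg_abs_le (ε * value g x)
    have h4 := (abs_le.1 (abs_W_le x)).1
    linarith
  refine ⟨value g, fun x => max (hjLhs ε g x) 0, bracket g,
    ⟨memLp_of_continuous hcv 4, hb4, isWeakDeriv_value ig⟩, hmm,
    Eventually.of_forall fun x => le_max_right _ _, ?_, ?_, ?_, ?_, ?_⟩
  · have := hEL (ψ := ContinuousMap.const _ 1) (ψ' := ContinuousMap.const _ 0)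
      (fun t => by simpa using hasDerivAt_const t (1:ℝ))
    simp only [ContinuousMap.const_apply, mul_one, mul_zero, integral_zero, add_zero,
      integral_const, probReal_univ, smul_eq_mul] at this
    exact mul_left_cancel₀ hε.ne' (this.trans (mul_one ε).symm)
  · simpa only [deriv_ham] using himb
  · refine Eventually.of_forall fun x hx => ?_
    have h0 : 0 < hjLhs ε g x := by
      by_contra hn
      simp only [max_eq_right (not_lt.1 hn), lt_irrefl] at hx
    simp only [ham_eq, coupling, max_eq_left h0.le]
    rw [hjLhs]; ring
  · refine Eventually.of_forall fun x => ?_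
    rw [ham_eq, coupling]
    refine le_trans (le_of_eq ?_) (le_max_left _ _)
    rw [hjLhs]; ring
  · intro ψ ψ' hψ
    simpa only [deriv_ham] using hEL hψ

end MFG

end

theorem mainTheorem4 :
    -- for each `ε > 0` the discount problem has exactly one weak solution
    (∀ ε : ℝ, 0 < ε → ∃ u m : MFG.Torus → ℝ, MFG.DiscountSol ε u m ∧
      ∀ u' m' : MFG.Torus → ℝ, MFG.DiscountSol ε u' m' → u' =ᵐ[volume] u ∧ m' =ᵐ[volume] m) ∧
    -- the whole family `⟨u^ε⟩` (continuous representatives) converges uniformly to `ũ`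
    (∀ u m : ℝ → MFG.Torus → ℝ, (∀ ε : ℝ, 0 < ε → MFG.DiscountSol ε (u ε) (m ε)) →
      ∃ U : ℝ → C(MFG.Torus, ℝ), (∀ ε : ℝ, 0 < ε → u ε =ᵐ[volume] U ε) ∧
        TendstoUniformly (fun ε => MFG.bracket (U ε)) MFG.uTilde (𝓝[>] (0 : ℝ))) ∧
    -- `ũ` has mean zero
    (∫ x, MFG.uTilde x = 0) ∧
    -- the `u^θ` are a continuum of weak solutions of the ergodic problem
    (∀ θ ∈ Icc (1 / 8 : ℝ) (3 / 8), ∀ C : ℝ, MFG.ErgodicSol (MFG.uTheta θ C) MFG.mErg 0) ∧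
    (∀ θ ∈ Icc (1 / 8 : ℝ) (3 / 8), ∀ θ' ∈ Icc (1 / 8 : ℝ) (3 / 8), ∀ C C' : ℝ,
      MFG.uTheta θ C =ᵐ[volume] MFG.uTheta θ' C' → θ = θ') ∧
    -- the selection criterion singles out `ũ`, up to additive constants
    MFG.uTilde ∈ MFG.admissible ∧
    IsMinOn MFG.criterion MFG.admissible MFG.uTilde ∧
    (∀ u ∈ MFG.admissible, IsMinOn MFG.criterion MFG.admissible u →
      ∃ c : ℝ, u =ᵐ[volume] fun x => MFG.uTilde x + c) := by
  refine ⟨fun ε hε => ?_, fun u m h => MFG.tendstoUniformly_bracket h, MFG.integral_uTilde,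
    fun θ hθ C => MFG.ergodicSol_uTheta hθ C, fun θ hθ θ' hθ' C C' h =>
      le_antisymm (MFG.uTheta_le_of_ae_eq hθ' hθ h.symm) (MFG.uTheta_le_of_ae_eq hθ hθ' h),
    MFG.uTilde_mem_admissible, MFG.isMinOn_criterion_uTilde,
    fun u hu hmin => MFG.eq_uTilde_of_isMinOn hu hmin⟩
  obtain ⟨u, m, hum⟩ := MFG.exists_discountSol hε
  obtain ⟨v, hv⟩ := hum.exists_data hε
  refine ⟨u, m, hum, fun u' m' h' => ?_⟩
  obtain ⟨v', hv'⟩ := h'.exists_data hε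
  exact hv'.unique hε hv
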